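/- Let $p>2$ be a prime, $\mathbb F$ a finite field of characteristic $p$, and $A$ a commutative compact (Hausdorff) topological $\mathbb F$-algebra which is semi-local and such that $\mathbb F\to A/\mathfrak m$ is surjective for every maximal ideal $\mathfrak m$ of $A$. Let $\Pi$ be a profinite group such that the maximal pro-$p$ quotient of every open subgroup of $\Pi$ is topologically finitely generated. For every maximal ideal $\mathfrak m$ of $A$ let $\bar\rho_{\mathfrak m}:\Pi\to \mathrm{GL}_2(\mathbb F)$ be a continuous representation which is absolutely irreducible or conjugate to the sum of two distinct characters $\Pi\to\mathbb F^*$. Let $t:\Pi\to A$ be a continuous map and $d:\Pi\to A^*$ a continuous homomorphism such that $(t,d)$ is a two-dimensional pseudo-representation, i.e. $t(xy)=t(yx)$, $t(1)=2$ and $t(xy)+d(y)t(xy^{-1})=t(x)t(y)$ for all $x,y\in\Pi$. Assume that $(\Pi,\bar\rho,t,d)$ is an admissible pseudo-deformation: $t\equiv\operatorname{tr}\bar\rho_{\mathfrak m}$ and $d\equiv\det\bar\rho_{\mathfrak m}\pmod{\mathfrak m}$ for every $\mathfrak m$; $d(g)$ lies in the image of $\mathbb F$ in $A$ for all $g\in\Pi$;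 and the $\mathbb F$-subalgebra of $A$ generated by $t(\Pi)$ is dense in $A$. Let $\rho:\Pi\to R^*$ be a $(t,d)$-representation. That is, $R=\begin{pmatrix}A&B\\ C&A\end{pmatrix}$ is a generalized matrix algebra, where $B,C$ are $A$-modules with a bilinear map $B\times C\to A$, $(b,c)\mapsto bc$, such that $(bc)b'=(b'c)b$ and $(bc')c=(bc)c'$, and $R$ is multiplied by the usual rule for matrices; $R$ is faithful, i.e. $y=0$ is the only $y\in R$ with $\det y=0$ and $\operatorname{tr}(yx)=0$ for all $x\in R$; and $\rho$ is a homomorphism with $\operatorname{tr}\rho=t$, $\det\rho=d$ whose image spans $R$ as an $A$-module. Give $R$ its $A$-module topology, let $\operatorname{rad}R$ be its Jacobson radical, and put $G=\rho(\Pi)$ and $\bar G=$ the image of $G$ in $(R/\operatorname{rad}R)^*$. Let $\Gamma$ be the group of the $g\in G$ with $\det g=1$ and $g-1\in\operatorname{rad}R$; let $L$ be the closure of the additive subgroup of $R$ generated by the elements $\gamma-\tfrac12\operatorname{tr}(\gamma)\,\mathrm{Id}$, $\gamma\in\Gamma$, and let $L_2$ be the closure of the additive subgroup generated by the commutators $xy-yx$,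 $x,y\in L$. Let $S$ be the set of the $g\in G$ such that $\operatorname{tr} g=0$ and $-\det g$ is the square of an element of $A^*$, and let $$A_{\mathrm{ess}}=\sum_{g\in S}\mathbb F\operatorname{tr}(gL_2)\subset A .$$ Assume that $(\Pi,\bar\rho,t,d)$ is weakly odd, i.e. $S\neq\emptyset$. Let $l:A\to\mathbb F$ be an $\mathbb F$-linear form that is not identically $0$ on $A_{\mathrm{ess}}$. Then $\bar G$ is finite and, with $n=|\bar G|$, $$\mu_\Pi\bigl(\{g\in\Pi: l(t(g))\neq0\}\bigr)\ \ge\ \frac{p-1}{pn},$$ where $\mu_\Pi$ is the Haar measure on $\Pi$ of total mass $1$ (understood as the outer measure if $l$ is not continuous and the set is not measurable). -/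

import Mathlib

open MeasureTheory TopologicalSpace

noncomputable section

/-! ### Profinite groups and the `p`-finiteness condition -/

/-- The kernel of the projection of a topological group `H` onto its maximal pro-`p` quotient:
the intersection of all open normal subgroups of `H` whose index is a power of `p`. -/
def maxProPKernel (p : ℕ) (H : Type*) [Group H] [TopologicalSpace H] : Subgroup H :=
  sInf {U : Subgroup H | U.Normal ∧ IsOpen (U : Set H) ∧ ∃ k : ℕ, U.index = p ^ k}

instance maxProPKernel_normal (p : ℕ) (H : Type*) [Group H] [TopologicalSpace H] :
    (maxProPKernel p H).Normal := by
  constructor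
  intro x hx g
  rw [maxProPKernel, Subgroup.mem_sInf] at hx ⊢
  intro U hU
  exact hU.1.conj_mem x (hx U hU) g

/-- A topological group is topologically finitely generated if some finitely generated subgroup
is dense. -/
def TopologicallyFG (H : Type*) [Group H] [TopologicalSpace H] : Prop :=
  ∃ s : Set H, s.Finite ∧ Dense (Subgroup.closure s : Set H)

/-- Mazur's finiteness condition at `p`: the maximal pro-`p` quotient of every open subgroup is
topologically finitely generated. -/
def PFinitenessCondition (p : ℕ) (PG : Type*) [Group PG] [TopologicalSpace PG] : Prop :=
  ∀ H : Subgroup PG, IsOpen (H : Set PG) → TopologicallyFG (H ⧸ maxProPKernel p H)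

/-! ### Residual representations -/

/-- The representation on column vectors defined by a homomorphism to `GL₂(K)`. -/
def vectorRep {PG K : Type*} [Group PG] [Field K] (r : PG →* GL (Fin 2) K) :
    Representation K PG (Fin 2 → K) :=
  ((Matrix.toLinAlgEquiv' : Matrix (Fin 2) (Fin 2) K ≃ₐ[K] _) : _ →* _).comp
    ((Units.coeHom (Matrix (Fin 2) (Fin 2) K)).comp r)

/-- Absolute irreducibility: irreducibility over an algebraic closure. -/
def IsAbsolutelyIrreducible {PG F : Type*} [Group PG] [Field F] (r : PG →* GL (Fin 2) F) : Prop :=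
  (vectorRep ((Matrix.GeneralLinearGroup.map (algebraMap F (AlgebraicClosure F))).comp
    r)).IsIrreducible

/-- `r` is conjugate to the direct sum of two distinct characters with values in `Fˣ`. -/
def IsSumOfTwoDistinctCharacters {PG F : Type*} [Group PG] [Field F]
    (r : PG →* GL (Fin 2) F) : Prop :=
  ∃ χ₁ χ₂ : PG →* Fˣ, χ₁ ≠ χ₂ ∧ ∃ P : GL (Fin 2) F, ∀ g : PG,
    (r g : Matrix (Fin 2) (Fin 2) F) * P = P * Matrix.diagonal ![(χ₁ g : F), (χ₂ g : F)]

/-! ### Pseudo-representations of dimension two -/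

/-- Two-dimensional pseudo-representations of a group with values in a commutative ring. -/
structure IsPseudoRep {PG A : Type*} [Group PG] [CommRing A] (t : PG → A) (d : PG →* Aˣ) : Prop where
  central : ∀ x y, t (x * y) = t (y * x)
  map_one : t 1 = 2
  identity : ∀ x y, t (x * y) + d y * t (x * y⁻¹) = t x * t y

/-! ### Generalized matrix algebras -/

/-- The data defining a generalized matrix algebra (of type `(1,1)`) over `A`: a bilinear map
`m : B × C → A` with the two conditions that make matrix multiplication associative. -/
structure GMA (A B C : Type*) [CommRing A] [AddCommGroup B] [Module A B] [AddCommGroup C]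
    [Module A C] where
  m : B →ₗ[A] C →ₗ[A] A
  assoc_left : ∀ b b' c, m b c • b' = m b' c • b
  assoc_right : ∀ b c c', m b c' • c = m b c • c'

namespace GMA

variable {A B C : Type*} [CommRing A] [AddCommGroup B] [Module A B] [AddCommGroup C] [Module A C]

/-- The underlying module of the algebra `R = A ⊕ B ⊕ C ⊕ A`; the quadruple `(a, b, c, d)` stands
for the matrix with rows `(a, b)` and `(c, d)`. -/
def Alg (_ : GMA A B C) : Type _ := A × B × C × A

variable (R : GMA A B C)

instance : AddCommGroup R.Alg := inferInstanceAs (AddCommGroup (A × B × C × A))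

instance : Module A R.Alg := inferInstanceAs (Module A (A × B × C × A))

variable {R}

/-- The matrix with rows `(a, b)` and `(c, d)`. -/
def ofEntries (a : A) (b : B) (c : C) (d : A) : R.Alg := (a, b, c, d)

/-- The upper left entry. -/
def e₁₁ (x : R.Alg) : A := Prod.fst x

/-- The upper right entry. -/
def e₁₂ (x : R.Alg) : B := (Prod.snd x).1

/-- The lower left entry. -/
def e₂₁ (x : R.Alg) : C := (Prod.snd x).2.1

/-- The lower right entry. -/
def e₂₂ (x : R.Alg) : A := (Prod.snd x).2.2

theorem alg_ext {x y : R.Alg} (h₁ : e₁₁ x = e₁₁ y) (h₂ : e₁₂ x = e₁₂ y) (h₃ : e₂₁ x = e₂₁ y)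
    (h₄ : e₂₂ x = e₂₂ y) : x = y :=
  Prod.ext h₁ (Prod.ext h₂ (Prod.ext h₃ h₄))

instance : Mul R.Alg :=
  ⟨fun x y => ofEntries (e₁₁ x * e₁₁ y + R.m (e₁₂ x) (e₂₁ y)) (e₁₁ x • e₁₂ y + e₂₂ y • e₁₂ x)
    (e₁₁ y • e₂₁ x + e₂₂ x • e₂₁ y) (e₂₂ x * e₂₂ y + R.m (e₁₂ y) (e₂₁ x))⟩

instance : One R.Alg := ⟨ofEntries 1 0 0 1⟩

section Entries

variable (x y : R.Alg) (r : A)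

theorem e₁₁_mul : e₁₁ (x * y) = e₁₁ x * e₁₁ y + R.m (e₁₂ x) (e₂₁ y) := rfl
theorem e₁₂_mul : e₁₂ (x * y) = e₁₁ x • e₁₂ y + e₂₂ y • e₁₂ x := rfl
theorem e₂₁_mul : e₂₁ (x * y) = e₁₁ y • e₂₁ x + e₂₂ x • e₂₁ y := rfl
theorem e₂₂_mul : e₂₂ (x * y) = e₂₂ x * e₂₂ y + R.m (e₁₂ y) (e₂₁ x) := rfl
theorem e₁₁_one : e₁₁ (1 : R.Alg) = 1 := rfl
theorem e₁₂_one : e₁₂ (1 : R.Alg) = 0 := rfl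
theorem e₂₁_one : e₂₁ (1 : R.Alg) = 0 := rfl
theorem e₂₂_one : e₂₂ (1 : R.Alg) = 1 := rfl
theorem e₁₁_add : e₁₁ (x + y) = e₁₁ x + e₁₁ y := rfl
theorem e₁₂_add : e₁₂ (x + y) = e₁₂ x + e₁₂ y := rfl
theorem e₂₁_add : e₂₁ (x + y) = e₂₁ x + e₂₁ y := rfl
theorem e₂₂_add : e₂₂ (x + y) = e₂₂ x + e₂₂ y := rfl
theorem e₁₁_zero : e₁₁ (0 : R.Alg) = 0 := rfl
theorem e₁₂_zero : e₁₂ (0 : R.Alg) = 0 := rfl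
theorem e₂₁_zero : e₂₁ (0 : R.Alg) = 0 := rfl
theorem e₂₂_zero : e₂₂ (0 : R.Alg) = 0 := rfl
theorem e₁₁_smul : e₁₁ (r • x) = r * e₁₁ x := rfl
theorem e₁₂_smul : e₁₂ (r • x) = r • e₁₂ x := rfl
theorem e₂₁_smul : e₂₁ (r • x) = r • e₂₁ x := rfl
theorem e₂₂_smul : e₂₂ (r • x) = r * e₂₂ x := rfl

end Entries

protected theorem mul_assoc (x y z : R.Alg) : x * y * z = x * (y * z) := by
  apply alg_ext
  · simp only [e₁₁_mul, e₁₂_mul, e₂₁_mul, map_add, map_smul, LinearMap.add_apply,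
      LinearMap.smul_apply, smul_eq_mul]
    ring
  · simp only [e₁₁_mul, e₁₂_mul, e₂₂_mul, smul_add, add_smul, smul_smul,
      R.assoc_left (e₁₂ x) (e₁₂ z) (e₂₁ y)]
    module
  · simp only [e₁₁_mul, e₂₁_mul, e₂₂_mul, smul_add, add_smul, smul_smul,
      R.assoc_right (e₁₂ y) (e₂₁ x) (e₂₁ z)]
    module
  · simp only [e₁₂_mul, e₂₁_mul, e₂₂_mul, map_add, map_smul, LinearMap.add_apply,
      LinearMap.smul_apply, smul_eq_mul]
    ring

instance : Ring R.Alg :=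
  { (inferInstance : AddCommGroup R.Alg), (inferInstance : Mul R.Alg),
    (inferInstance : One R.Alg) with
    mul_assoc := GMA.mul_assoc
    one_mul := fun x => by
      apply alg_ext <;>
        simp [e₁₁_mul, e₁₂_mul, e₂₁_mul, e₂₂_mul, e₁₁_one, e₁₂_one, e₂₁_one, e₂₂_one]
    mul_one := fun x => by
      apply alg_ext <;>
        simp [e₁₁_mul, e₁₂_mul, e₂₁_mul, e₂₂_mul, e₁₁_one, e₁₂_one, e₂₁_one, e₂₂_one]
    zero_mul := fun x => by
      apply alg_ext <;>
        simp [e₁₁_mul, e₁₂_mul, e₂₁_mul, e₂₂_mul, e₁₁_zero, e₁₂_zero, e₂₁_zero, e₂₂_zero]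
    mul_zero := fun x => by
      apply alg_ext <;>
        simp [e₁₁_mul, e₁₂_mul, e₂₁_mul, e₂₂_mul, e₁₁_zero, e₁₂_zero, e₂₁_zero, e₂₂_zero]
    left_distrib := fun x y z => by
      apply alg_ext <;>
        simp only [e₁₁_mul, e₁₂_mul, e₂₁_mul, e₂₂_mul, e₁₁_add, e₁₂_add, e₂₁_add, e₂₂_add,
          map_add, LinearMap.add_apply, smul_add, add_smul, mul_add] <;> abel
    right_distrib := fun x y z => by
      apply alg_ext <;>
        simp only [e₁₁_mul, e₁₂_mul, e₂₁_mul, e₂₂_mul, e₁₁_add, e₁₂_add, e₂₁_add, e₂₂_add,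
          map_add, LinearMap.add_apply, smul_add, add_smul, add_mul] <;> abel }

instance : Algebra A R.Alg :=
  Algebra.ofModule
    (fun r x y => by
      apply alg_ext <;>
        simp only [e₁₁_mul, e₁₂_mul, e₂₁_mul, e₂₂_mul, e₁₁_smul, e₁₂_smul, e₂₁_smul, e₂₂_smul,
          map_smul, LinearMap.smul_apply, smul_eq_mul, smul_add, smul_smul] <;>
        first
          | ring1
          | module)
    (fun r x y => by
      apply alg_ext <;>
        simp only [e₁₁_mul, e₁₂_mul, e₂₁_mul, e₂₂_mul, e₁₁_smul, e₁₂_smul, e₂₁_smul, e₂₂_smul,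
          map_smul, LinearMap.smul_apply, smul_eq_mul, smul_add, smul_smul] <;>
        first
          | ring1
          | module)

/-- The natural topology of the `A`-algebra `R`: its `A`-module topology. For `R` finite over a
compact ring `A` this is the quotient topology of any surjection `Aⁿ → R`. -/
instance [TopologicalSpace A] : TopologicalSpace R.Alg := moduleTopology A R.Alg

/-- The trace `a + d`. -/
def tr (x : R.Alg) : A := e₁₁ x + e₂₂ x

/-- The determinant `ad - bc`. -/
def det (x : R.Alg) : A := e₁₁ x * e₂₂ x - R.m (e₁₂ x) (e₂₁ x)

variable (R)

/-- `R` is faithful: the kernel of the pseudo-representation `(tr, det)` is zero. -/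
def IsFaithful : Prop :=
  ∀ y : R.Alg, det y = 0 → (∀ x : R.Alg, tr (y * x) = 0) → y = 0

/-- `SR¹`: the units of determinant `1` in `1 + rad R`, where `rad R` is the Jacobson radical. -/
def SR₁ : Set R.Algˣ :=
  {u | det (u : R.Alg) = 1 ∧ (u : R.Alg) - 1 ∈ Ring.jacobson R.Alg}

end GMA

/-- `ρ` is a `(t,d)`-representation: a homomorphism to the units of a faithful generalized matrix
algebra over `A` with trace `t` and determinant `d`, whose image generates the algebra as an
`A`-module. -/
structure IsTDRep {PG A B C : Type*} [Group PG] [CommRing A] [AddCommGroup B] [Module A B]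
    [AddCommGroup C] [Module A C] (t : PG → A) (d : PG →* Aˣ) (R : GMA A B C)
    (ρ : PG →* R.Algˣ) : Prop where
  faithful : R.IsFaithful
  tr_eq : ∀ g, GMA.tr (ρ g : R.Alg) = t g
  det_eq : ∀ g, GMA.det (ρ g : R.Alg) = d g
  span_eq_top : Submodule.span A (Set.range fun g => (ρ g : R.Alg)) = ⊤

/-! ### Admissible pseudo-deformations -/

/-- The `F`-algebra `A` is semi-local and all its residue fields are equal to `F`. -/
structure IsSemilocalWithResidueField (F A : Type*) [Field F] [CommRing A] [Algebra F A] :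
    Prop where
  semilocal : Finite (MaximalSpectrum A)
  residue : ∀ 𝔪 : MaximalSpectrum A,
    Function.Surjective ((Ideal.Quotient.mk 𝔪.asIdeal).comp (algebraMap F A))

/-- `(PG, ρbar, t, d)` is an admissible pseudo-deformation over the `F`-algebra `A`. The residual
representations are indexed by the maximal ideals of `A`. Since `A` is an `F`-algebra, the constants
of `A`, i.e. the Teichmüller lifts of elements of `F`, are the elements of the image of `F`. -/
structure IsAdmissiblePseudoDeformation (p : ℕ) {PG F A : Type*} [Group PG] [TopologicalSpace PG]
    [Field F] [TopologicalSpace F] [CommRing A] [TopologicalSpace A]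
    [Algebra F A] (ρbar : MaximalSpectrum A → (PG →* GL (Fin 2) F)) (t : PG → A) (d : PG →* Aˣ) :
    Prop where
  pFinite : PFinitenessCondition p PG
  residual_continuous : ∀ 𝔪, Continuous (ρbar 𝔪)
  residual_multiplicityFree : ∀ 𝔪,
    IsAbsolutelyIrreducible (ρbar 𝔪) ∨ IsSumOfTwoDistinctCharacters (ρbar 𝔪)
  pseudoRep : IsPseudoRep t d
  continuous_t : Continuous t
  continuous_d : Continuous fun g => (d g : A)
  deform_t : ∀ (𝔪 : MaximalSpectrum A) (g : PG),
    t g - algebraMap F A (Matrix.trace (ρbar 𝔪 g : Matrix (Fin 2) (Fin 2) F)) ∈ 𝔪.asIdeal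
  deform_d : ∀ (𝔪 : MaximalSpectrum A) (g : PG),
    (d g : A) - algebraMap F A (Matrix.det (ρbar 𝔪 g : Matrix (Fin 2) (Fin 2) F)) ∈ 𝔪.asIdeal
  constant_det : ∀ g, (d g : A) ∈ Set.range (algebraMap F A)
  generated : Dense (Algebra.adjoin F (Set.range t) : Set A)

/-! ### The essential submodule -/

namespace GMA

variable {PG F A B C : Type*} [Group PG] [Field F] [CommRing A] [Algebra F A] [AddCommGroup B]
  [Module A B] [AddCommGroup C] [Module A C] {R : GMA A B C}

/-- The subgroup `Ḡ` of `(R / rad R)ˣ`, image of the group `G = ρ(PG)`. -/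
def residualImage (ρ : PG →* R.Algˣ) : Subgroup (R.Alg ⧸ Ring.jacobson R.Alg)ˣ :=
  ρ.range.map (Units.map (Ideal.Quotient.mk (Ring.jacobson R.Alg)).toMonoidHom)

variable (F) in
/-- Pink's map `Θ(x) = x - (tr x / 2) Id`; the scalar `1/2` is taken in the field `F`. -/
def pinkTheta (x : R.Alg) : R.Alg := x - ((2⁻¹ : F) • tr x) • (1 : R.Alg)

/-- The closure of the additive subgroup of `R` generated by `X`. -/
def closedAddSpan [TopologicalSpace A] (X : Set R.Alg) : Set R.Alg :=
  closure (AddSubgroup.closure X : Set R.Alg)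

variable (F) in
/-- Pink's Lie algebra `L` of the group `ρ(PG) ∩ SR¹`: the closure of the additive subgroup
generated by its image under `Θ`. -/
def pinkLie [TopologicalSpace A] (ρ : PG →* R.Algˣ) : Set R.Alg :=
  closedAddSpan ((fun u : R.Algˣ => pinkTheta F (u : R.Alg)) '' ((ρ.range : Set R.Algˣ) ∩ R.SR₁))

variable (F) in
/-- The derived Lie algebra `L₂ = [L, L]`: the closure of the additive subgroup generated by the
commutators of elements of `L`. -/
def pinkLie₂ [TopologicalSpace A] (ρ : PG →* R.Algˣ) : Set R.Alg :=
  closedAddSpan {z | ∃ x ∈ pinkLie F ρ, ∃ y ∈ pinkLie F ρ, z = x * y - y * x}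

/-- The set `S` of the `g ∈ G = ρ(PG)` with `tr g = 0` such that `-det g` is a square in `Aˣ`. -/
def oddSet (ρ : PG →* R.Algˣ) : Set R.Algˣ :=
  {g | g ∈ ρ.range ∧ tr (g : R.Alg) = 0 ∧ ∃ a : Aˣ, -det (g : R.Alg) = (a : A) ^ 2}

/-- Weak oddness: the set `S` is nonempty. -/
def IsWeaklyOdd (ρ : PG →* R.Algˣ) : Prop := (oddSet ρ).Nonempty

variable (F) in
/-- The essential submodule `A_ess = ∑_{g ∈ S} F tr(g L₂)`. -/
def essentialSubmodule [TopologicalSpace A] (ρ : PG →* R.Algˣ) : Submodule F A :=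
  Submodule.span F {a | ∃ g ∈ oddSet ρ, ∃ x ∈ pinkLie₂ F ρ, a = tr ((g : R.Alg) * x)}

end GMA

end

/-! Choose g₀ with ρ(g₀) in S and x in L₂ such that l(tr(ρ(g₀)x)) ≠ 0, and let N be the kernel of ρ
modulo rad R, an open subgroup of measure 1/n. On N the determinant is a constant congruent to 1,
hence equal to 1, so ρ(N) = Γ. Since tr ρ(g₀) = 0, for h in N the value l(t(g₀h)) =
l(tr(ρ(g₀)Θ(ρ(h)))) is an additive function of Θ(ρ(h)). Pink's theory says that Θ is injective on Γ
and that Θ(Γ) is stable under translation by L₂. Along the p translates by multiples of x the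
function takes p distinct values, so it vanishes at most once. It is therefore nonzero on a
proportion at least (p-1)/p of N, and translation by g₀ preserves Haar measure.

The counting takes place in finite rings. For an open ideal I of A, the quotient of R by `traceIdeal
I` is finite with nilpotent radical J. There u - u⁻¹ = 2Θ(u), while u + u⁻¹ = tr(u) is central.
Modulo deeper terms of the descending central series of L, the odd part turns products into sums
(`oddPart_mul_sub_sub_mem`) and group commutators into half-brackets
(`two_oddPart_commutator_sub_mem`). So every graded piece is generated by odd parts of group
elements, and successive approximation, which stops because the series lies in powers of J, gives
the translation stability (`exists_oddPart_eq_add`).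

As l need not be continuous, its zero set need not be visible modulo any I. For a compact part M of
N on which l(t(g₀h)) = 0, the differences Θ(ρ(g)) - Θ(ρ(h)) - kx with 0 < k < p never vanish, and
compactness of M × M yields one open I modulo which they still do not
(`exists_open_ideal_sub_notMem`). Counting modulo I gives p μ(M) ≤ μ(N), and inner regularity
concludes. That A has enough open ideals follows from its exponent p, by Bogolyubov's lemma in
finite subgroups and a passage to an ultrafilter limit. -/

/-! ### Bogolyubov's lemma and compact groups of finite exponent -/

section Bogolyubov

variable {E : Type*} [AddCommGroup E] [Fintype E]

/-- Unnormalized Fourier coefficient of the indicator function of `S`. -/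
noncomputable def charSum (S : Finset E) (χ : AddChar E ℂ) : ℂ := ∑ s ∈ S, χ s

theorem charSum_mul_conj (S : Finset E) (χ : AddChar E ℂ) :
    charSum S χ * (starRingEnd ℂ) (charSum S χ) = ∑ a ∈ S, ∑ b ∈ S, χ (a - b) := by
  rw [charSum, map_sum, Finset.sum_mul_sum]
  refine Finset.sum_congr rfl fun a _ => Finset.sum_congr rfl fun b _ => ?_
  rw [← AddChar.map_neg_eq_conj, sub_eq_add_neg, AddChar.map_add_eq_mul]

/-- Parseval's identity for the indicator function of `S`. -/
theorem sum_norm_sq_charSum (S : Finset E) :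
    ∑ χ : AddChar E ℂ, ‖charSum S χ‖ ^ 2 = (Fintype.card E : ℝ) * S.card := by
  classical
  have h : ∑ χ : AddChar E ℂ, charSum S χ * (starRingEnd ℂ) (charSum S χ)
      = (Fintype.card E : ℂ) * S.card := by
    simp_rw [charSum_mul_conj]
    rw [Finset.sum_comm]
    have : ∀ a ∈ S, ∑ χ : AddChar E ℂ, ∑ b ∈ S, χ (a - b) = Fintype.card E := by
      intro a ha
      rw [Finset.sum_comm]
      simp_rw [AddChar.sum_apply_eq_ite, sub_eq_zero]
      simp [ha]
    rw [Finset.sum_congr rfl this]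
    simp [mul_comm]
  simp_rw [Complex.mul_conj, Complex.normSq_eq_norm_sq] at h
  exact_mod_cast h

/-- The fourth power of the Fourier coefficient expands into characters at the points (a - b) + (c -
d), so by orthogonality the sum counts the solutions of (a - b) + (c - d) + x = 0. -/
theorem sum_norm_pow_four_charSum_mul {S : Finset E} {x : E}
    (hx : ∀ a ∈ S, ∀ b ∈ S, ∀ c ∈ S, ∀ d ∈ S, (a - b) + (c - d) + x ≠ 0) :
    ∑ χ : AddChar E ℂ, ((‖charSum S χ‖ ^ 4 : ℝ) : ℂ) * χ x = 0 := by
  classical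
  have h : ∀ χ : AddChar E ℂ, ((‖charSum S χ‖ ^ 4 : ℝ) : ℂ) * χ x
      = ∑ a ∈ S, ∑ b ∈ S, ∑ c ∈ S, ∑ d ∈ S, χ ((a - b) + (c - d) + x) := by
    intro χ
    have h2 : ((‖charSum S χ‖ ^ 4 : ℝ) : ℂ)
        = (charSum S χ * (starRingEnd ℂ) (charSum S χ)) ^ 2 := by
      rw [Complex.mul_conj, Complex.normSq_eq_norm_sq]
      push_cast
      ring
    rw [h2, charSum_mul_conj, sq, Finset.sum_mul, Finset.sum_mul]
    refine Finset.sum_congr rfl fun a _ => ?_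
    rw [Finset.sum_mul, Finset.sum_mul]
    refine Finset.sum_congr rfl fun b _ => ?_
    rw [Finset.mul_sum, Finset.sum_mul]
    refine Finset.sum_congr rfl fun c _ => ?_
    rw [Finset.mul_sum, Finset.sum_mul]
    refine Finset.sum_congr rfl fun d _ => ?_
    rw [AddChar.map_add_eq_mul, AddChar.map_add_eq_mul]
  simp_rw [h]
  rw [Finset.sum_comm]
  refine Finset.sum_eq_zero fun a ha => ?_
  rw [Finset.sum_comm]
  refine Finset.sum_eq_zero fun b hb => ?_
  rw [Finset.sum_comm]
  refine Finset.sum_eq_zero fun c hc => ?_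
  rw [Finset.sum_comm]
  refine Finset.sum_eq_zero fun d hd => ?_
  rw [AddChar.sum_apply_eq_ite, if_neg (hx a ha b hb c hc d hd)]

/-- If `x` is killed by all characters with a large Fourier coefficient on `S`, then `x` lies in
`S - S + S - S`. -/
theorem mem_of_forall_large_char {S : Finset E} {θ : ℝ} (hS : S.Nonempty)
    (hθ : θ * Fintype.card E < (S.card : ℝ) ^ 3) {x : E}
    (hx : ∀ χ : AddChar E ℂ, θ ≤ ‖charSum S χ‖ ^ 2 → χ x = 1) :
    ∃ a ∈ S, ∃ b ∈ S, ∃ c ∈ S, ∃ d ∈ S, x = (a - b) + (c - d) := by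
  classical
  by_contra hcon
  have h0 := sum_norm_pow_four_charSum_mul (S := S) (x := x) (by
    intro a ha b hb c hc d hd h
    refine hcon ⟨b, hb, a, ha, d, hd, c, hc, ?_⟩
    rw [eq_neg_of_add_eq_zero_right h]
    abel)
  have h1 : ∑ χ : AddChar E ℂ, ‖charSum S χ‖ ^ 4 * (χ x).re = 0 := by
    have := congrArg Complex.re h0
    simpa only [Complex.re_sum, Complex.re_ofReal_mul, Complex.zero_re] using this
  have hScard : (0 : ℝ) < S.card := by exact_mod_cast hS.card_pos
  -- The trivial character contributes |S|⁴, the other large ones something nonnegative, and each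
  -- small one at least -θ times its squared coefficient. By Parseval the total is at least |S|⁴ -
  -- θ|E||S| > 0, contradicting `h1`.
  have h2 : ∀ χ : AddChar E ℂ, (if χ = 0 then (S.card : ℝ) ^ 4 else 0)
      - (if θ ≤ ‖charSum S χ‖ ^ 2 then 0 else θ * ‖charSum S χ‖ ^ 2)
      ≤ ‖charSum S χ‖ ^ 4 * (χ x).re := by
    intro χ
    by_cases hb : θ ≤ ‖charSum S χ‖ ^ 2
    · rw [if_pos hb, hx χ hb]
      split_ifs with h
      · subst h
        simp [charSum]
      · simp
    · have hre : -1 ≤ (χ x).re := by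
        have := (abs_le.1 (Complex.abs_re_le_norm (χ x))).1
        rwa [AddChar.norm_apply] at this
      rw [if_neg hb]
      push Not at hb
      split_ifs with h
      · exfalso
        subst h
        simp only [charSum, AddChar.zero_apply, Finset.sum_const, nsmul_eq_mul, mul_one,
          Complex.norm_natCast] at hb
        have hle : (S.card : ℝ) ≤ Fintype.card E := by exact_mod_cast S.card_le_univ
        nlinarith [sq_nonneg (S.card : ℝ), mul_le_mul_of_nonneg_left hle (sq_nonneg (S.card : ℝ))]
      · nlinarith [sq_nonneg (‖charSum S χ‖ ^ 2), mul_le_mul_of_nonneg_left hre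
          (sq_nonneg (‖charSum S χ‖ ^ 2)), mul_le_mul_of_nonneg_right hb.le
          (sq_nonneg ‖charSum S χ‖)]
  have h3 := Finset.sum_le_sum fun χ (_ : χ ∈ (Finset.univ : Finset (AddChar E ℂ))) => h2 χ
  rw [h1, Finset.sum_sub_distrib, Finset.sum_ite_eq' Finset.univ (0 : AddChar E ℂ)] at h3
  simp only [Finset.mem_univ, if_true] at h3
  rcases le_total 0 θ with hθ0 | hθ0
  · have h4 : ∑ χ : AddChar E ℂ, (if θ ≤ ‖charSum S χ‖ ^ 2 then 0 else θ * ‖charSum S χ‖ ^ 2)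
        ≤ θ * ((Fintype.card E : ℝ) * S.card) := by
      rw [← sum_norm_sq_charSum, Finset.mul_sum]
      refine Finset.sum_le_sum fun χ _ => ?_
      split_ifs
      · positivity
      · rfl
    nlinarith [mul_lt_mul_of_pos_right hθ hScard]
  · have h4 : ∑ χ : AddChar E ℂ, (if θ ≤ ‖charSum S χ‖ ^ 2 then 0 else θ * ‖charSum S χ‖ ^ 2)
        ≤ 0 := by
      refine Finset.sum_nonpos fun χ _ => ?_
      split_ifs
      · rfl
      · exact mul_nonpos_of_nonpos_of_nonneg hθ0 (by positivity)
    have : 0 < (S.card : ℝ) ^ 4 := by positivity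
    linarith

/-- Markov's inequality applied to Parseval's identity. -/
theorem card_large_char_mul_le (S : Finset E) (θ : ℝ) [DecidablePred fun χ : AddChar E ℂ =>
      θ ≤ ‖charSum S χ‖ ^ 2] :
    ((Finset.univ.filter fun χ : AddChar E ℂ => θ ≤ ‖charSum S χ‖ ^ 2).card : ℝ) * θ
      ≤ Fintype.card E * S.card := by
  rw [← sum_norm_sq_charSum, ← nsmul_eq_mul, ← Finset.sum_const]
  refine (Finset.sum_le_sum fun χ hχ => (Finset.mem_filter.1 hχ).2).trans ?_
  exact Finset.sum_le_sum_of_subset_of_nonneg (Finset.filter_subset _ _) fun _ _ _ => by positivity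

/-- Bogolyubov's lemma for finite abelian groups of exponent `p`. -/
theorem exists_addSubgroup_index_le_of_card_le {p : ℕ} [NeZero p] (hp : ∀ x : E, p • x = 0)
    {S : Finset E} (hS : S.Nonempty) {m : ℕ} (hm : Fintype.card E ≤ m * S.card) :
    ∃ W : AddSubgroup E, W.index ≤ p ^ (2 * m ^ 2) ∧
      ∀ x ∈ W, ∃ a ∈ S, ∃ b ∈ S, ∃ c ∈ S, ∃ d ∈ S, x = (a - b) + (c - d) := by
  classical
  have hScard : (0 : ℝ) < S.card := by exact_mod_cast hS.card_pos
  have hE : (0 : ℝ) < Fintype.card E := by exact_mod_cast Fintype.card_pos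
  -- Half of the threshold |S|³/|E| required above. The large characters then number at most
  -- |E||S|/θ = 2|E|²/|S|² ≤ 2m².
  set θ : ℝ := (S.card : ℝ) ^ 3 / (2 * Fintype.card E) with hθ
  have hθpos : 0 < θ := by positivity
  have hθE : θ * Fintype.card E = (S.card : ℝ) ^ 3 / 2 := by
    rw [hθ]; field_simp
  set X := Finset.univ.filter fun χ : AddChar E ℂ => θ ≤ ‖charSum S χ‖ ^ 2 with hX
  have hXcard : X.card ≤ 2 * m ^ 2 := by
    have h1 := card_large_char_mul_le S θ
    rw [← hX] at h1
    have hm' : (Fintype.card E : ℝ) ≤ m * S.card := by exact_mod_cast hm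
    have h2 : (X.card : ℝ) * (S.card : ℝ) ^ 3 / 2 ≤ (Fintype.card E : ℝ) ^ 2 * S.card := by
      calc (X.card : ℝ) * (S.card : ℝ) ^ 3 / 2 = X.card * θ * Fintype.card E := by
            rw [mul_assoc, hθE]; ring
        _ ≤ Fintype.card E * S.card * Fintype.card E := by gcongr
        _ = _ := by ring
    have h3 : (Fintype.card E : ℝ) ^ 2 * S.card ≤ (m * S.card) ^ 2 * S.card := by gcongr
    have h4 : (X.card : ℝ) * (S.card : ℝ) ^ 3 ≤ 2 * m ^ 2 * (S.card : ℝ) ^ 3 := by nlinarith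
    have h5 := le_of_mul_le_mul_right h4 (by positivity)
    exact_mod_cast h5
  -- Joint evaluation at the large characters. Exponent p puts the values among the p-th roots of
  -- unity, which bounds the index of the kernel by p to the number of large characters.
  let ev : E →+ (X → Additive (rootsOfUnity p ℂ)) :=
    { toFun := fun x χ => Additive.ofMul (rootsOfUnity.mkOfPowEq (χ.1 x) (by
        rw [← AddChar.map_nsmul_eq_pow, hp, AddChar.map_zero_eq_one]))
      map_zero' := by
        funext χ
        apply Additive.toMul.injective
        ext
        simp
      map_add' := fun x y => by
        funext χ
        apply Additive.toMul.injective
        ext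
        simp [AddChar.map_add_eq_mul] }
  refine ⟨ev.ker, ?_, fun x hx => mem_of_forall_large_char hS (θ := θ) ?_ fun χ hχ => ?_⟩
  · rw [AddSubgroup.index_ker]
    refine (Nat.card_le_card_of_injective _ (Subtype.val_injective)).trans ?_
    rw [Nat.card_pi, Finset.prod_const, Finset.card_univ, Fintype.card_coe]
    refine (Nat.pow_le_pow_left (?_ : _ ≤ p) _).trans
      (Nat.pow_le_pow_right (NeZero.pos p) hXcard)
    have : Nat.card (Additive (rootsOfUnity p ℂ)) = Nat.card (rootsOfUnity p ℂ) := rfl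
    rw [this]
    exact card_rootsOfUnity ℂ p
  · rw [hθE]
    have : 0 < (S.card : ℝ) ^ 3 := by positivity
    linarith
  · have h := congrFun ((AddMonoidHom.mem_ker).1 hx) ⟨χ, by simp [hX, hχ]⟩
    have h' := congrArg (fun z : Additive (rootsOfUnity p ℂ) => ((z.toMul : ℂˣ) : ℂ)) h
    simpa [ev] using h'

end Bogolyubov

/-! ### Open subgroups and open ideals in exponent p -/

section CompactExponent

variable {M : Type*} [AddCommGroup M]

theorem AddSubgroup.finite_closure_of_module {K : Type*} [Ring K] [Finite K] [Module K M]
    {s : Set M} (hs : s.Finite) : Finite (AddSubgroup.closure s) := by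
  have h1 : Module.Finite K (Submodule.span K s) := Module.Finite.span_of_finite K hs
  have h2 : Finite (Submodule.span K s) := Module.finite_of_finite K
  have h3 : AddSubgroup.closure s ≤ (Submodule.span K s).toAddSubgroup :=
    (AddSubgroup.closure_le _).2 Submodule.subset_span
  exact Finite.of_injective (β := Submodule.span K s) _ (AddSubgroup.inclusion_injective h3)

theorem AddSubgroup.finite_closure_of_exponent {p : ℕ} [Fact p.Prime] (hp : ∀ x : M, p • x = 0)
    {s : Set M} (hs : s.Finite) : Finite (AddSubgroup.closure s) :=
  @AddSubgroup.finite_closure_of_module M _ (ZMod p) _ _ (AddCommGroup.zmodModule hp) s hs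

/-- A family of points of an additive group that are pairwise distinct modulo a subgroup has at
most as many members as the index of the subgroup. -/
theorem card_le_index_of_pairwise_sub_notMem {E : Type*} [AddCommGroup E] [Finite E]
    (W : AddSubgroup E) {k : ℕ} (x : Fin k → E) (hx : ∀ i j, i ≠ j → x i - x j ∉ W) :
    k ≤ W.index := by
  have hinj : Function.Injective fun i => (QuotientAddGroup.mk (x i) : E ⧸ W) := by
    intro i j hij
    by_contra hne
    refine hx j i (Ne.symm hne) ?_
    have := QuotientAddGroup.eq.1 hij
    rwa [neg_add_eq_sub] at this
  simpa [AddSubgroup.index] using Nat.card_le_card_of_injective _ hinj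

variable [TopologicalSpace M] [IsTopologicalAddGroup M] [CompactSpace M]

theorem exists_finset_forall_exists_sub_mem {U : Set M} (hU : U ∈ nhds (0 : M)) :
    ∃ s : Finset M, ∀ x, ∃ e ∈ s, x - e ∈ U := by
  obtain ⟨s, -, hs⟩ := isCompact_univ.elim_nhds_subcover (fun e : M => (fun x => x - e) ⁻¹' U)
    (fun e _ => by
      have : ContinuousAt (fun x : M => x - e) e := by fun_prop
      exact this.preimage_mem_nhds (by simpa using hU))
  refine ⟨s, fun x => ?_⟩
  have := hs (Set.mem_univ x)
  simpa using this

/-- In a compact abelian group of prime exponent, the open subgroups form a basis of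
neighbourhoods of `0`. -/
theorem exists_open_addSubgroup_subset {p : ℕ} [Fact p.Prime] (hp : ∀ x : M, p • x = 0)
    {V : Set M} (hV : V ∈ nhds (0 : M)) :
    ∃ W : AddSubgroup M, IsOpen (W : Set M) ∧ (W : Set M) ⊆ V := by
  classical
  obtain ⟨V', hV'nhds, hV'closed, hV'V⟩ := exists_mem_nhds_isClosed_subset hV
  have hcont : Filter.Tendsto (fun z : (M × M) × (M × M) => (z.1.1 - z.1.2) + (z.2.1 - z.2.2))
      (nhds 0) (nhds 0) := by
    have : Continuous fun z : (M × M) × (M × M) => (z.1.1 - z.1.2) + (z.2.1 - z.2.2) := by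
      fun_prop
    simpa using this.tendsto 0
  have hpre := hcont hV'nhds
  rw [show (0 : (M × M) × (M × M)) = ((0, 0), (0, 0)) from rfl, nhds_prod_eq, nhds_prod_eq,
    Filter.mem_map] at hpre
  obtain ⟨U₁, hU₁, U₂, hU₂, hsub⟩ := Filter.mem_prod_iff.1 hpre
  obtain ⟨U₁a, hU₁a, U₁b, hU₁b, hsub₁⟩ := Filter.mem_prod_iff.1 hU₁
  obtain ⟨U₂a, hU₂a, U₂b, hU₂b, hsub₂⟩ := Filter.mem_prod_iff.1 hU₂
  set U := (U₁a ∩ U₁b) ∩ (U₂a ∩ U₂b) with hUdef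
  have hU : U ∈ nhds (0 : M) := by
    rw [hUdef]
    exact Filter.inter_mem (Filter.inter_mem hU₁a hU₁b) (Filter.inter_mem hU₂a hU₂b)
  have hUV : ∀ a ∈ U, ∀ b ∈ U, ∀ c ∈ U, ∀ d ∈ U, (a - b) + (c - d) ∈ V' := by
    intro a ha b hb c hc d hd
    have h1 : (a, b) ∈ U₁ := hsub₁ ⟨ha.1.1, hb.1.2⟩
    have h2 : (c, d) ∈ U₂ := hsub₂ ⟨hc.2.1, hd.2.2⟩
    exact hsub (Set.mk_mem_prod h1 h2)
  obtain ⟨t, ht⟩ := exists_finset_forall_exists_sub_mem hU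
  -- Adjoining the covering set `t` to every `s` makes the `t`-translates of U ∩ E s cover E s. Its
  -- density is thus at least 1/|t|, and the index bound from Bogolyubov's lemma is uniform in `s`.
  let E : Finset M → AddSubgroup M := fun s => AddSubgroup.closure (↑(s ∪ t) : Set M)
  have hEfin : ∀ s, Finite (E s) := fun s =>
    AddSubgroup.finite_closure_of_exponent hp (Finset.finite_toSet _)
  have hW : ∀ s, ∃ W : AddSubgroup (E s), W.index ≤ p ^ (2 * t.card ^ 2) ∧
      ∀ x ∈ W, (x : M) ∈ V' := by
    intro s
    have := hEfin s
    let _ : Fintype (E s) := Fintype.ofFinite _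
    let S : Finset (E s) := Finset.univ.filter fun x => (x : M) ∈ U
    have hcover : ∀ x : E s, ∃ e ∈ t, ∃ y ∈ S, (x : M) = y + e := by
      intro x
      obtain ⟨e, he, hxe⟩ := ht x
      have heE : e ∈ E s := AddSubgroup.subset_closure (by simp [he])
      exact ⟨e, he, ⟨x - e, (E s).sub_mem x.2 heE⟩, by simpa [S] using hxe, by simp⟩
    have hcard : Fintype.card (E s) ≤ t.card * S.card := by
      rw [← Finset.card_product, ← Finset.card_univ,
        ← Finset.card_image_of_injective _ (Subtype.val_injective (p := (· ∈ E s)))]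
      refine (Finset.card_le_card (t := (t ×ˢ S).image fun z => (z.2 : M) + z.1) ?_).trans
        Finset.card_image_le
      intro x hx
      obtain ⟨x, -, rfl⟩ := Finset.mem_image.1 hx
      obtain ⟨e, he, y, hy, hxy⟩ := hcover x
      exact Finset.mem_image.2 ⟨(e, y), Finset.mk_mem_product he hy, hxy.symm⟩
    have hS : S.Nonempty := by
      obtain ⟨e, he, y, hy, -⟩ := hcover 0
      exact ⟨y, hy⟩
    obtain ⟨W, hWi, hWS⟩ := exists_addSubgroup_index_le_of_card_le
      (fun x : E s => Subtype.ext (hp x)) hS hcard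
    refine ⟨W, hWi, fun x hx => ?_⟩
    obtain ⟨a, ha, b, hb, c, hc, d, hd, rfl⟩ := hWS x hx
    simp only [S, Finset.mem_filter, Finset.mem_univ, true_and] at ha hb hc hd
    exact hUV _ ha _ hb _ hc _ hd
  choose W hWi hWV using hW
  -- The subgroups `W s` are glued into their limit along an ultrafilter refining `atTop`. Any
  -- finite tuple eventually lies in E s, so the uniform index bound survives.
  let 𝒰 : Ultrafilter (Finset M) := Ultrafilter.of Filter.atTop
  have h𝒰 : ∀ s₀ : Finset M, ∀ᶠ s in (𝒰 : Filter (Finset M)), s₀ ≤ s := fun s₀ =>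
    Ultrafilter.of_le _ (Filter.eventually_ge_atTop s₀)
  let W' : AddSubgroup M :=
    { carrier := {x | ∀ᶠ s in (𝒰 : Filter (Finset M)), x ∈ (W s).map (E s).subtype}
      zero_mem' := Filter.Eventually.of_forall fun s => AddSubgroup.zero_mem _
      add_mem' := fun hx hy => by
        filter_upwards [hx, hy] with s h1 h2 using AddSubgroup.add_mem _ h1 h2
      neg_mem' := fun hx => by
        filter_upwards [hx] with s h1 using AddSubgroup.neg_mem _ h1 }
  have hW'V : (W' : Set M) ⊆ V' := by
    intro x hx
    obtain ⟨s, hs⟩ := (show ∀ᶠ s in (𝒰 : Filter (Finset M)), _ from hx).exists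
    obtain ⟨y, hy, rfl⟩ := hs
    exact hWV s y hy
  have hindex : ∀ x : Fin (p ^ (2 * t.card ^ 2) + 1) → M, ∃ i j, i ≠ j ∧ x i - x j ∈ W' := by
    intro x
    by_contra hcon
    push Not at hcon
    have hev : ∀ᶠ s in (𝒰 : Filter (Finset M)), ∀ i j, i ≠ j →
        x i - x j ∉ (W s).map (E s).subtype := by
      rw [Filter.eventually_all]
      intro i
      rw [Filter.eventually_all]
      intro j
      by_cases hij : i = j
      · exact Filter.Eventually.of_forall fun s h => absurd hij h
      · have := Ultrafilter.eventually_not.2 (hcon i j hij)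
        filter_upwards [this] with s hs _ using hs
    obtain ⟨s, hs, hsx⟩ := (hev.and (h𝒰 (Finset.univ.image x))).exists
    have hmem : ∀ i, x i ∈ E s := fun i =>
      AddSubgroup.subset_closure (by
        have := hsx (Finset.mem_image_of_mem x (Finset.mem_univ i))
        simp [this])
    have := hEfin s
    have h := card_le_index_of_pairwise_sub_notMem (W s) (fun i => ⟨x i, hmem i⟩)
      (fun i j hij hmemW => hs i j hij ⟨_, hmemW, rfl⟩)
    exact absurd (h.trans (hWi s)) (by omega)
  have hfin : Finite (M ⧸ W') := by
    by_contra hinf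
    rw [not_finite_iff_infinite] at hinf
    let f := Infinite.natEmbedding (M ⧸ W')
    obtain ⟨i, j, hij, hmem⟩ := hindex fun i => (f i).out
    refine hij (Fin.ext (f.injective ?_))
    rw [← QuotientAddGroup.out_eq' (f i), ← QuotientAddGroup.out_eq' (f j)]
    refine (QuotientAddGroup.eq.2 ?_).symm
    rwa [neg_add_eq_sub]
  -- `W'` need not be open. Its closure is closed of finite index, hence open, and stays inside the
  -- closed set `V'`.
  have hfi : W'.FiniteIndex := AddSubgroup.finiteIndex_of_finite_quotient
  have hfi' : W'.topologicalClosure.FiniteIndex :=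
    AddSubgroup.finiteIndex_of_le W'.le_topologicalClosure
  refine ⟨W'.topologicalClosure, AddSubgroup.isOpen_of_isClosed_of_finiteIndex _
    W'.isClosed_topologicalClosure, ?_⟩
  exact (closure_minimal hW'V hV'closed).trans hV'V

end CompactExponent

/-- In a compact commutative ring of prime characteristic, the open ideals form a basis of
neighbourhoods of `0`. -/
theorem exists_open_ideal_subset {A : Type*} [CommRing A] [TopologicalSpace A]
    [IsTopologicalRing A] [CompactSpace A] {p : ℕ} [Fact p.Prime] (hp : ∀ x : A, p • x = 0)
    {V : Set A} (hV : V ∈ nhds (0 : A)) :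
    ∃ I : Ideal A, IsOpen (I : Set A) ∧ (I : Set A) ⊆ V := by
  obtain ⟨W, hWo, hWV⟩ := exists_open_addSubgroup_subset hp hV
  -- The largest ideal contained in `W`. It is open because a * x ∈ W holds near x = 0 uniformly in
  -- a, by compactness of A.
  let I : Ideal A :=
    { carrier := {x | ∀ a, a * x ∈ W}
      zero_mem' := fun a => by simp
      add_mem' := fun hx hy a => by rw [mul_add]; exact W.add_mem (hx a) (hy a)
      smul_mem' := fun c x hx a => by rw [smul_eq_mul, ← mul_assoc]; exact hx _ }
  refine ⟨I, ?_, fun x hx => hWV (by simpa using hx 1)⟩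
  have hnhds : (I : Set A) ∈ nhds (0 : A) := by
    have := isCompact_univ.eventually_forall_of_forall_eventually (x₀ := (0 : A))
      (P := fun x a => a * x ∈ W) (K := (Set.univ : Set A)) (fun a _ => by
        have hc : Continuous fun z : A × A => z.2 * z.1 := by fun_prop
        exact (hWo.preimage hc).mem_nhds (by simp))
    filter_upwards [this] with x hx a using hx a trivial
  exact AddSubgroup.isOpen_of_mem_nhds I.toAddSubgroup hnhds

/-! ### Pink's theory in a ring with nilpotent radical -/

section Pink

variable {Q : Type*} [Ring Q]

/-- The odd part `u - u⁻¹` of a unit. -/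
def oddPart (u : Qˣ) : Q := ↑u - ↑u⁻¹

/-- The even part `u + u⁻¹` of a unit. -/
def evenPart (u : Qˣ) : Q := ↑u + ↑u⁻¹

/-- The anticommutator `xy + yx`. -/
def anticomm (x y : Q) : Q := x * y + y * x

/-- The descending central series of the Lie ring generated by the odd parts of the elements
of `Γ`. -/
def lieSeries (Γ : Subgroup Qˣ) : ℕ → AddSubgroup Q
  | 0 => AddSubgroup.closure (oddPart '' (Γ : Set Qˣ))
  | n + 1 => AddSubgroup.closure
      {z | ∃ x ∈ AddSubgroup.closure (oddPart '' (Γ : Set Qˣ)), ∃ y ∈ lieSeries Γ n, z = ⁅x, y⁆}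

theorem anticomm_comm (x y : Q) : anticomm x y = anticomm y x := by
  simp only [anticomm, add_comm]

theorem oddPart_inv (u : Qˣ) : oddPart u⁻¹ = -oddPart u := by
  simp [oddPart]

/-- The source of centrality: once even parts are central, so are anticommutators of odd parts. -/
theorem anticomm_oddPart (u v : Qˣ) : anticomm (oddPart u) (oddPart v) =
    evenPart (u * v) + evenPart (v * u) - evenPart (u * v⁻¹) - evenPart (u⁻¹ * v) := by
  simp only [anticomm, oddPart, evenPart, mul_inv_rev, inv_inv, Units.val_mul]
  noncomm_ring

/-- The reason the additive group generated by the odd parts is closed under brackets. -/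
theorem lie_oddPart (u v : Qˣ) : ⁅oddPart u, oddPart v⁆ =
    oddPart (u * v) - oddPart (v * u) - oddPart (u * v⁻¹) - oddPart (u⁻¹ * v) := by
  simp only [Ring.lie_def, oddPart, mul_inv_rev, inv_inv, Units.val_mul]
  noncomm_ring

/-- The vector triple product formula of sl₂, with the anticommutator in the role of the scalar
product. -/
theorem lie_lie_eq_anticomm {x y z : Q} (hxy : Commute (anticomm x y) z)
    (hxz : Commute (anticomm x z) y) :
    ⁅x, ⁅y, z⁆⁆ = (anticomm x y * z - anticomm x z * y) + (anticomm x y * z - anticomm x z * y) := by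
  have h : ⁅x, ⁅y, z⁆⁆ =
      anticomm x y * z + z * anticomm x y - y * anticomm x z - anticomm x z * y := by
    simp only [Ring.lie_def, anticomm]
    noncomm_ring
  rw [h, ← hxy.eq, ← hxz.eq]
  abel

/-- With central anticommutators, (x, y, z) ↦ {x, [y, z]} behaves as an alternating triple product.
-/
theorem anticomm_lie_swap {x y z : Q} (h : Commute (anticomm x y) z) :
    anticomm x ⁅y, z⁆ = -anticomm y ⁅x, z⁆ := by
  rw [eq_neg_iff_add_eq_zero, ← sub_eq_zero.2 h.eq]
  simp only [Ring.lie_def, anticomm]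
  noncomm_ring

/-- The relation cosh² = sinh² + 1, multiplied by 4. It lets the odd part control the even part. -/
theorem evenPart_mul_self_sub (u : Qˣ) :
    evenPart u * evenPart u = oddPart u * oddPart u + 4 := by
  have h1 := u.mul_inv
  have h2 := u.inv_mul
  have : evenPart u * evenPart u = oddPart u * oddPart u + 2 * (u * ↑u⁻¹) + 2 * (↑u⁻¹ * u) := by
    simp only [evenPart, oddPart]; noncomm_ring
  rw [this, h1, h2, add_assoc]
  norm_num

/-- The addition formula for sinh, with a bracket as noncommutative correction. -/
theorem four_oddPart_mul {u v : Qˣ} (hu : ∀ q, Commute (evenPart u) q)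
    (hv : ∀ q, Commute (evenPart v) q) :
    4 * oddPart (u * v) = ⁅oddPart u, oddPart v⁆ + 2 * (evenPart u * oddPart v)
      + 2 * (evenPart v * oddPart u) := by
  have h : 4 * oddPart (u * v) = ⁅oddPart u, oddPart v⁆ + oddPart u * evenPart v
      + evenPart u * oddPart v + evenPart v * oddPart u + oddPart v * evenPart u
      + (evenPart u * evenPart v - evenPart v * evenPart u) := by
    simp only [Ring.lie_def, oddPart, evenPart, mul_inv_rev, Units.val_mul]
    noncomm_ring
  rw [h, (hu (evenPart v)).eq, ← (hu (oddPart v)).eq, ← (hv (oddPart u)).eq]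
  noncomm_ring

/-- Twice the left side is, up to sign, the bracket of x with the central element {y, y}. -/
theorem anticomm_lie_self (h2 : ∀ a : Q, a + a = 0 → a = 0) {x y : Q}
    (hy : ∀ q, Commute (anticomm y y) q) : anticomm ⁅x, y⁆ y = 0 := by
  refine h2 _ ?_
  rw [← sub_eq_zero.2 (hy x).eq.symm]
  simp only [Ring.lie_def, anticomm]
  noncomm_ring

theorem two_mul_lie_mul (h2 : ∀ a : Q, a + a = 0 → a = 0) {x y : Q}
    (hy : ∀ q, Commute (anticomm y y) q) : 2 * (⁅x, y⁆ * y) = -⁅y, ⁅x, y⁆⁆ := by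
  have h := anticomm_lie_self (x := x) h2 hy
  rw [anticomm] at h
  rw [Ring.lie_def y, eq_neg_of_add_eq_zero_left h]
  have : y * ⁅x, y⁆ = - (⁅x, y⁆ * y) := eq_neg_of_add_eq_zero_right h
  rw [this]
  noncomm_ring

/-- The odd part of uvu⁻¹v⁻¹ factors as (uv - vu)(u⁻¹v⁻¹ + v⁻¹u⁻¹), and each factor is expanded in
odd and even parts. Near the identity even parts are close to 2, so the first term on the right is
close to 8 times the bracket; the remaining terms will lie deeper in the central series. -/
theorem oddPart_commutator_eq (h2 : ∀ a : Q, a + a = 0 → a = 0) {u v : Qˣ}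
    (hu : ∀ q, Commute (evenPart u) q) (hv : ∀ q, Commute (evenPart v) q)
    (huv : ∀ q, Commute (anticomm (oddPart u) (oddPart v)) q)
    (huu : ∀ q, Commute (anticomm (oddPart u) (oddPart u)) q)
    (hvv : ∀ q, Commute (anticomm (oddPart v) (oddPart v)) q) :
    16 * oddPart (u * v * u⁻¹ * v⁻¹) =
      2 * (evenPart u * (evenPart v * ⁅oddPart u, oddPart v⁆))
      + anticomm (oddPart u) (oddPart v) * ⁅oddPart u, oddPart v⁆
      + evenPart u * ⁅oddPart v, ⁅oddPart u, oddPart v⁆⁆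
      - evenPart v * ⁅oddPart u, ⁅oddPart v, oddPart u⁆⁆ := by
  have e1 : oddPart (u * v * u⁻¹ * v⁻¹)
      = (u * v - v * u : Q) * (↑u⁻¹ * ↑v⁻¹ + ↑v⁻¹ * ↑u⁻¹) := by
    have : (u * v - v * u : Q) * (↑u⁻¹ * ↑v⁻¹ + ↑v⁻¹ * ↑u⁻¹) =
        ((u * v * u⁻¹ * v⁻¹ : Qˣ) : Q) + ((u * v * (v⁻¹ * u⁻¹) : Qˣ) : Q)
        - ((v * u * (u⁻¹ * v⁻¹) : Qˣ) : Q) - ((v * u * v⁻¹ * u⁻¹ : Qˣ) : Q) := by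
      simp only [Units.val_mul]; noncomm_ring
    rw [this, oddPart]
    simp only [mul_inv_rev, inv_inv]
    rw [show u * v * (v⁻¹ * u⁻¹) = 1 by group, show v * u * (u⁻¹ * v⁻¹) = 1 by group,
      show v * u * v⁻¹ * u⁻¹ = v * (u * (v⁻¹ * u⁻¹)) by group]
    abel
  have e2 : 4 * (u * v - v * u : Q) = ⁅oddPart u, oddPart v⁆ := by
    have : 4 * (u * v - v * u : Q) = ⁅oddPart u, oddPart v⁆
        + (evenPart u * oddPart v - oddPart v * evenPart u)
        - (evenPart v * oddPart u - oddPart u * evenPart v)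
        + (evenPart u * evenPart v - evenPart v * evenPart u) := by
      simp only [Ring.lie_def, oddPart, evenPart]; noncomm_ring
    rw [this, (hu (evenPart v)).eq, (hu (oddPart v)).eq, (hv (oddPart u)).eq]
    abel
  have e3 : 4 * (↑u⁻¹ * ↑v⁻¹ + ↑v⁻¹ * ↑u⁻¹ : Q) = 2 * (evenPart u * evenPart v)
      - 2 * (evenPart u * oddPart v) - 2 * (evenPart v * oddPart u)
      + anticomm (oddPart u) (oddPart v) := by
    have : 4 * (↑u⁻¹ * ↑v⁻¹ + ↑v⁻¹ * ↑u⁻¹ : Q) = evenPart u * evenPart v + evenPart v * evenPart u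
      - evenPart u * oddPart v - oddPart v * evenPart u - evenPart v * oddPart u
      - oddPart u * evenPart v + anticomm (oddPart u) (oddPart v) := by
      simp only [anticomm, oddPart, evenPart]; noncomm_ring
    rw [this, (hu (evenPart v)).eq, (hu (oddPart v)).eq, (hv (oddPart u)).eq]
    noncomm_ring
  have e4 := two_mul_lie_mul (x := oddPart u) h2 hvv
  have e5 := two_mul_lie_mul (x := oddPart v) h2 huu
  have e6 : ⁅oddPart v, oddPart u⁆ = -⁅oddPart u, oddPart v⁆ := by
    simp only [Ring.lie_def]; abel
  have e7 : 16 * oddPart (u * v * u⁻¹ * v⁻¹)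
      = (4 * (u * v - v * u : Q)) * (4 * (↑u⁻¹ * ↑v⁻¹ + ↑v⁻¹ * ↑u⁻¹ : Q)) := by
    rw [e1]; noncomm_ring
  rw [e7, e2, e3]
  rw [e6] at e5 ⊢
  set W := ⁅oddPart u, oddPart v⁆
  have e8 : W * (2 * (evenPart u * evenPart v) - 2 * (evenPart u * oddPart v)
      - 2 * (evenPart v * oddPart u) + anticomm (oddPart u) (oddPart v))
      = 2 * ((W * evenPart u) * evenPart v) - 2 * ((W * evenPart u) * oddPart v)
        - 2 * ((W * evenPart v) * oddPart u) + W * anticomm (oddPart u) (oddPart v) := by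
    noncomm_ring
  rw [e8, ← (hu W).eq, ← (hv W).eq, ← (huv W).eq, mul_assoc, mul_assoc, mul_assoc,
    ← (hv W).eq]
  have e9 : 2 * (evenPart u * (W * oddPart v)) = evenPart u * (2 * (W * oddPart v)) := by
    noncomm_ring
  have e10 : 2 * (evenPart v * (W * oddPart u)) = - (evenPart v * (2 * (-W * oddPart u))) := by
    noncomm_ring
  rw [e9, e10, e4, e5]
  noncomm_ring

theorem lieSeries_zero (Γ : Subgroup Qˣ) :
    lieSeries Γ 0 = AddSubgroup.closure (oddPart '' (Γ : Set Qˣ)) := rfl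

end Pink

/-! ### Depth estimates in the central series and successive approximation -/

section PinkSeries

variable {Q : Type*} [Ring Q]

/-- Taking the inverse of 2 to be a natural number makes halving preserve every additive subgroup.
-/
theorem AddSubgroup.mem_of_add_self_mem {k : ℕ} (hk : (2 * k : Q) = 1) {M : AddSubgroup Q} {x : Q}
    (hx : x + x ∈ M) : x ∈ M := by
  have : x = k • (x + x) := by
    rw [nsmul_eq_mul, ← two_mul, ← mul_assoc, ← (Nat.cast_commute k (2 : Q)).eq.symm, hk, one_mul]
  rw [this]
  exact M.nsmul_mem hx k

theorem AddSubgroup.mem_of_two_pow_mul_mem {k : ℕ} (hk : (2 * k : Q) = 1) {M : AddSubgroup Q}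
    (n : ℕ) {x : Q} (hx : 2 ^ n * x ∈ M) : x ∈ M := by
  induction n with
  | zero => simpa using hx
  | succ n ih =>
    refine ih (AddSubgroup.mem_of_add_self_mem hk ?_)
    rwa [← two_mul, ← mul_assoc, ← pow_succ']

theorem eq_zero_of_add_self_eq_zero {k : ℕ} (hk : (2 * k : Q) = 1) (x : Q) (hx : x + x = 0) :
    x = 0 :=
  AddSubgroup.mem_bot.1 (AddSubgroup.mem_of_add_self_mem hk (AddSubgroup.mem_bot.2 hx))

/-- If `σ` is nilpotent, the additive group `M` is stable by `σ`, and `(σ² + 4σ) w ∈ M`,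
then `σ w ∈ M`. -/
theorem mul_mem_of_sq_add_four_mul_mem {k : ℕ} (hk : (2 * k : Q) = 1) {M : AddSubgroup Q}
    {σ w : Q} (hσ : IsNilpotent σ) (hM : ∀ z ∈ M, σ * z ∈ M) (hw : (σ * σ + 4 * σ) * w ∈ M) :
    σ * w ∈ M := by
  obtain ⟨N, hN⟩ := hσ
  have hpow : ∀ (j : ℕ), ∀ z ∈ M, σ ^ j * z ∈ M := by
    intro j
    induction j with
    | zero => intro z hz; simpa using hz
    | succ j ih => intro z hz; rw [pow_succ, mul_assoc]; exact ih _ (hM z hz)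
  have key : ∀ d j : ℕ, N ≤ j + d → σ ^ (j + 1) * w ∈ M := by
    intro d
    induction d with
    | zero =>
      intro j hj
      rw [pow_eq_zero_of_le (by omega) hN, zero_mul]
      exact M.zero_mem
    | succ d ih =>
      intro j hj
      have h1 := ih (j + 1) (by omega)
      have h2 := hpow j _ hw
      refine AddSubgroup.mem_of_two_pow_mul_mem hk 2 ?_
      have : 2 ^ 2 * (σ ^ (j + 1) * w) = σ ^ j * ((σ * σ + 4 * σ) * w) - σ ^ (j + 1 + 1) * w := by
        rw [pow_succ σ (j + 1), pow_succ σ j]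
        noncomm_ring
      rw [this]
      exact M.sub_mem h2 h1
  simpa using key N 0 (by omega)

variable {Γ : Subgroup Qˣ}

theorem lie_mem_lieSeries {n : ℕ} {x y : Q} (hx : x ∈ lieSeries Γ 0) (hy : y ∈ lieSeries Γ n) :
    ⁅x, y⁆ ∈ lieSeries Γ (n + 1) :=
  AddSubgroup.subset_closure ⟨x, hx, y, hy, rfl⟩

theorem oddPart_mem_lieSeries {u : Qˣ} (hu : u ∈ Γ) : oddPart u ∈ lieSeries Γ 0 :=
  AddSubgroup.subset_closure ⟨u, hu, rfl⟩

theorem lie_mem_of_mem_closure {s t : Set Q} {N : AddSubgroup Q}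
    (h : ∀ x ∈ s, ∀ y ∈ t, ⁅x, y⁆ ∈ N) {x y : Q} (hx : x ∈ AddSubgroup.closure s)
    (hy : y ∈ AddSubgroup.closure t) : ⁅x, y⁆ ∈ N := by
  simp only [Ring.lie_def] at h ⊢
  induction hx using AddSubgroup.closure_induction with
  | mem x hx =>
    induction hy using AddSubgroup.closure_induction with
    | mem y hy => exact h x hx y hy
    | zero => simp
    | add y z _ _ h1 h2 =>
      convert N.add_mem h1 h2 using 1
      noncomm_ring
    | neg y _ h =>
      convert N.neg_mem h using 1
      noncomm_ring
  | zero => simp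
  | add y z _ _ h1 h2 =>
    convert N.add_mem h1 h2 using 1
    noncomm_ring
  | neg y _ h =>
    convert N.neg_mem h using 1
    noncomm_ring

theorem lie_mem_lieSeries_zero {x y : Q} (hx : x ∈ lieSeries Γ 0) (hy : y ∈ lieSeries Γ 0) :
    ⁅x, y⁆ ∈ lieSeries Γ 0 := by
  refine lie_mem_of_mem_closure ?_ hx hy
  rintro _ ⟨u, hu, rfl⟩ _ ⟨v, hv, rfl⟩
  rw [lie_oddPart]
  have hu' := Γ.inv_mem hu
  have hv' := Γ.inv_mem hv
  exact AddSubgroup.sub_mem _ (AddSubgroup.sub_mem _ (AddSubgroup.sub_mem _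
    (oddPart_mem_lieSeries (Γ.mul_mem hu hv)) (oddPart_mem_lieSeries (Γ.mul_mem hv hu)))
    (oddPart_mem_lieSeries (Γ.mul_mem hu hv'))) (oddPart_mem_lieSeries (Γ.mul_mem hu' hv))

theorem lieSeries_succ_le (n : ℕ) : lieSeries Γ (n + 1) ≤ lieSeries Γ n := by
  induction n with
  | zero =>
    refine (AddSubgroup.closure_le _).2 ?_
    rintro _ ⟨x, hx, y, hy, rfl⟩
    exact lie_mem_lieSeries_zero hx hy
  | succ n ih =>
    refine (AddSubgroup.closure_le _).2 ?_
    rintro _ ⟨x, hx, y, hy, rfl⟩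
    exact lie_mem_lieSeries hx (ih hy)

theorem lieSeries_antitone : Antitone (lieSeries Γ) := antitone_nat_of_succ_le lieSeries_succ_le

theorem mul_mem_lieSeries {c : Q} (hc : ∀ q, Commute c q)
    (h0 : ∀ z ∈ lieSeries Γ 0, c * z ∈ lieSeries Γ 0) (n : ℕ) :
    ∀ z ∈ lieSeries Γ n, c * z ∈ lieSeries Γ n := by
  induction n with
  | zero => exact h0
  | succ n ih =>
    intro z hz
    rw [lieSeries] at hz
    induction hz using AddSubgroup.closure_induction with
    | mem z hz =>
      obtain ⟨x, hx, y, hy, rfl⟩ := hz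
      have : c * ⁅x, y⁆ = ⁅x, c * y⁆ := by
        simp only [Ring.lie_def, mul_sub, ← mul_assoc, (hc x).eq]
      rw [this]
      exact lie_mem_lieSeries hx (ih y hy)
    | zero => simp
    | add x y _ _ h1 h2 => rw [mul_add]; exact AddSubgroup.add_mem _ h1 h2
    | neg x _ h => rw [mul_neg]; exact AddSubgroup.neg_mem _ h

/-- On generators, the even part of u times the odd part of v is the sum of the odd parts of vu and
vu⁻¹. Central factors then pass through brackets to the deeper terms. -/
theorem evenPart_mul_mem_lieSeries
    (hΓ : ∀ u ∈ Γ, ∀ q : Q, Commute (evenPart u) q)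
    {u : Qˣ} (hu : u ∈ Γ) (n : ℕ) :
    ∀ z ∈ lieSeries Γ n, evenPart u * z ∈ lieSeries Γ n := by
  refine mul_mem_lieSeries (hΓ u hu) (fun z hz => ?_) n
  rw [lieSeries_zero] at hz
  induction hz using AddSubgroup.closure_induction with
  | mem z hz =>
    obtain ⟨v, hv, rfl⟩ := hz
    have : evenPart u * oddPart v = oddPart (v * u) + oddPart (v * u⁻¹) := by
      rw [oddPart, mul_sub, (hΓ u hu (v : Q)).eq]
      simp only [evenPart, oddPart, mul_inv_rev, inv_inv, Units.val_mul]
      noncomm_ring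
    rw [this]
    exact AddSubgroup.add_mem _ (oddPart_mem_lieSeries (Γ.mul_mem hv hu))
      (oddPart_mem_lieSeries (Γ.mul_mem hv (Γ.inv_mem hu)))
  | zero => simp
  | add x y _ _ h1 h2 => rw [mul_add]; exact AddSubgroup.add_mem _ h1 h2
  | neg x _ h => rw [mul_neg]; exact AddSubgroup.neg_mem _ h

/-- Anticommutators of elements of the Lie ring are central and act on the Lie ring. -/
theorem anticomm_central_and_mul_mem
    (hΓ : ∀ u ∈ Γ, ∀ q : Q, Commute (evenPart u) q)
    {x y : Q} (hx : x ∈ lieSeries Γ 0)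
    (hy : y ∈ lieSeries Γ 0) :
    (∀ q, Commute (anticomm x y) q) ∧
      ∀ z ∈ lieSeries Γ 0, anticomm x y * z ∈ lieSeries Γ 0 := by
  rw [lieSeries_zero] at hx hy
  induction hx, hy using AddSubgroup.closure_induction₂ with
  | mem x y hx hy =>
    obtain ⟨u, hu, rfl⟩ := hx
    obtain ⟨v, hv, rfl⟩ := hy
    have h1 := Γ.mul_mem hu hv
    have h2 := Γ.mul_mem hv hu
    have h3 := Γ.mul_mem hu (Γ.inv_mem hv)
    have h4 := Γ.mul_mem (Γ.inv_mem hu) hv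
    rw [anticomm_oddPart]
    refine ⟨fun q => (((hΓ _ h1 q).add_left (hΓ _ h2 q)).sub_left (hΓ _ h3 q)).sub_left
      (hΓ _ h4 q), fun z hz => ?_⟩
    rw [sub_mul, sub_mul, add_mul]
    exact AddSubgroup.sub_mem _ (AddSubgroup.sub_mem _ (AddSubgroup.add_mem _
      (evenPart_mul_mem_lieSeries hΓ h1 0 z hz) (evenPart_mul_mem_lieSeries hΓ h2 0 z hz))
      (evenPart_mul_mem_lieSeries hΓ h3 0 z hz)) (evenPart_mul_mem_lieSeries hΓ h4 0 z hz)
  | zero_left x hx => simp [anticomm]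
  | zero_right x hx => simp [anticomm]
  | add_left x y z _ _ _ h1 h2 =>
    rw [show anticomm (x + y) z = anticomm x z + anticomm y z by simp only [anticomm]; noncomm_ring]
    refine ⟨fun q => (h1.1 q).add_left (h2.1 q), fun w hw => ?_⟩
    rw [add_mul]
    exact AddSubgroup.add_mem _ (h1.2 w hw) (h2.2 w hw)
  | add_right y z x _ _ _ h1 h2 =>
    rw [show anticomm x (y + z) = anticomm x y + anticomm x z by simp only [anticomm]; noncomm_ring]
    refine ⟨fun q => (h1.1 q).add_left (h2.1 q), fun w hw => ?_⟩
    rw [add_mul]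
    exact AddSubgroup.add_mem _ (h1.2 w hw) (h2.2 w hw)
  | neg_left x y _ _ h =>
    rw [show anticomm (-x) y = -anticomm x y by simp only [anticomm]; noncomm_ring]
    refine ⟨fun q => (h.1 q).neg_left, fun w hw => ?_⟩
    rw [neg_mul]
    exact AddSubgroup.neg_mem _ (h.2 w hw)
  | neg_right x y _ _ h =>
    rw [show anticomm x (-y) = -anticomm x y by simp only [anticomm]; noncomm_ring]
    refine ⟨fun q => (h.1 q).neg_left, fun w hw => ?_⟩
    rw [neg_mul]
    exact AddSubgroup.neg_mem _ (h.2 w hw)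

theorem anticomm_central
    (hΓ : ∀ u ∈ Γ, ∀ q : Q, Commute (evenPart u) q)
    {x y : Q} (hx : x ∈ lieSeries Γ 0) (hy : y ∈ lieSeries Γ 0) :
    ∀ q, Commute (anticomm x y) q :=
  (anticomm_central_and_mul_mem hΓ hx hy).1

theorem anticomm_mul_sub_mem
    (hΓ : ∀ u ∈ Γ, ∀ q : Q, Commute (evenPart u) q) {k : ℕ} (hk : (2 * k : Q) = 1)
    {n : ℕ} {x y z : Q} (hx : x ∈ lieSeries Γ 0)
    (hy : y ∈ lieSeries Γ 0) (hz : z ∈ lieSeries Γ n) :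
    anticomm x y * z - anticomm x z * y ∈ lieSeries Γ (n + 2) := by
  have hz0 : z ∈ lieSeries Γ 0 := lieSeries_antitone (Nat.zero_le n) hz
  refine AddSubgroup.mem_of_add_self_mem hk ?_
  rw [← lie_lie_eq_anticomm (anticomm_central hΓ hx hy z) (anticomm_central hΓ hx hz0 y)]
  exact lie_mem_lieSeries hx (lie_mem_lieSeries hy hz)

/-- Modulo `lieSeries Γ 2`, the expression {u, [x, y]}v is symmetric under exchange of v with an
argument of the triple product, by the triple product formula, yet alternating in u, x, y. Such
exchanges generate all transpositions, so twice the expression vanishes. One more use of the formula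
replaces {u, [x, y]}v by {u, v}[x, y]. -/
theorem anticomm_mul_lie_mem
    (hΓ : ∀ u ∈ Γ, ∀ q : Q, Commute (evenPart u) q) {k : ℕ} (hk : (2 * k : Q) = 1)
    {u v x y : Q} (hu : u ∈ lieSeries Γ 0) (hv : v ∈ lieSeries Γ 0)
    (hx : x ∈ lieSeries Γ 0) (hy : y ∈ lieSeries Γ 0) :
    anticomm u v * ⁅x, y⁆ ∈ lieSeries Γ 2 := by
  have hle : ∀ {z}, z ∈ lieSeries Γ 3 → z ∈ lieSeries Γ 2 := fun hz => lieSeries_succ_le 2 hz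
  have hswap : ∀ {u v x y : Q}, u ∈ lieSeries Γ 0 → v ∈ lieSeries Γ 0 → x ∈ lieSeries Γ 0 →
      y ∈ lieSeries Γ 0 → anticomm u ⁅x, y⁆ * v - anticomm v ⁅x, y⁆ * u ∈ lieSeries Γ 2 := by
    intro u v x y hu hv hx hy
    have h1 := hle (anticomm_mul_sub_mem hΓ hk hu hv (lie_mem_lieSeries hx hy))
    have h2 := hle (anticomm_mul_sub_mem hΓ hk hv hu (lie_mem_lieSeries hx hy))
    rw [anticomm_comm v u] at h2
    convert AddSubgroup.sub_mem _ h2 h1 using 1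
    abel
  have hanti : ∀ {x y : Q} (z : Q), x ∈ lieSeries Γ 0 → y ∈ lieSeries Γ 0 →
      anticomm x ⁅y, z⁆ = -anticomm y ⁅x, z⁆ := fun z hx hy =>
    anticomm_lie_swap (anticomm_central hΓ hx hy z)
  have h1 := hswap hx hv hu hy
  rw [hanti y hx hu, hanti y hv hu] at h1
  have h2 := hswap hu hx hv hy
  rw [hanti y hx hv] at h2
  have h3 := hswap hv hu hx hy
  have h4 : anticomm u ⁅x, y⁆ * v ∈ lieSeries Γ 2 := by
    refine AddSubgroup.mem_of_add_self_mem hk ?_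
    convert AddSubgroup.sub_mem _ (AddSubgroup.sub_mem _ h2 h1) h3 using 1
    noncomm_ring
  have h5 := hle (anticomm_mul_sub_mem hΓ hk hu hv (lie_mem_lieSeries hx hy))
  convert AddSubgroup.add_mem _ h5 h4 using 1
  abel

theorem anticomm_mul_mem_succ
    (hΓ : ∀ u ∈ Γ, ∀ q : Q, Commute (evenPart u) q) {k : ℕ} (hk : (2 * k : Q) = 1)
    {u v : Q} (hu : u ∈ lieSeries Γ 0) (hv : v ∈ lieSeries Γ 0)
    (n : ℕ) : ∀ z ∈ lieSeries Γ (n + 1), anticomm u v * z ∈ lieSeries Γ (n + 2) := by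
  induction n with
  | zero =>
    intro z hz
    rw [lieSeries] at hz
    induction hz using AddSubgroup.closure_induction with
    | mem z hz =>
      obtain ⟨x, hx, y, hy, rfl⟩ := hz
      exact anticomm_mul_lie_mem hΓ hk hu hv hx hy
    | zero => simp
    | add x y _ _ h1 h2 => rw [mul_add]; exact AddSubgroup.add_mem _ h1 h2
    | neg x _ h => rw [mul_neg]; exact AddSubgroup.neg_mem _ h
  | succ n ih =>
    intro z hz
    rw [lieSeries] at hz
    induction hz using AddSubgroup.closure_induction with
    | mem z hz =>
      obtain ⟨x, hx, y, hy, rfl⟩ := hz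
      have : anticomm u v * ⁅x, y⁆ = ⁅x, anticomm u v * y⁆ := by
        simp only [Ring.lie_def, mul_sub, ← mul_assoc, (anticomm_central hΓ hu hv x).eq]
      rw [this]
      exact lie_mem_lieSeries hx (ih y hy)
    | zero => simp
    | add x y _ _ h1 h2 => rw [mul_add]; exact AddSubgroup.add_mem _ h1 h2
    | neg x _ h => rw [mul_neg]; exact AddSubgroup.neg_mem _ h

/-- For σ = `evenPart u - 2` one has σ² + 4σ = `oddPart u` squared, which is half the
anticommutator. Since σ is nilpotent, the factor σ + 4 can be divided out. -/
theorem evenPart_sub_two_mul_mem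
    (hΓ : ∀ u ∈ Γ, ∀ q : Q, Commute (evenPart u) q) {k : ℕ} (hk : (2 * k : Q) = 1)
    (hnil : ∀ u ∈ Γ, IsNilpotent (evenPart u - 2))
    {u : Qˣ} (hu : u ∈ Γ) {n : ℕ} {w : Q}
    (hw : anticomm (oddPart u) (oddPart u) * w ∈ lieSeries Γ n) :
    (evenPart u - 2) * w ∈ lieSeries Γ n := by
  refine mul_mem_of_sq_add_four_mul_mem hk (hnil u hu) (fun z hz => ?_) ?_
  · rw [sub_mul, two_mul]
    exact AddSubgroup.sub_mem _ (evenPart_mul_mem_lieSeries hΓ hu n z hz)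
      (AddSubgroup.add_mem _ hz hz)
  · refine AddSubgroup.mem_of_add_self_mem hk ?_
    have h1 : (evenPart u - 2) * (evenPart u - 2) + 4 * (evenPart u - 2)
        = evenPart u * evenPart u - 4 := by
      rw [show (4 : Q) = 2 + 2 by norm_num]
      noncomm_ring
    rw [h1, evenPart_mul_self_sub, add_sub_cancel_right, ← add_mul]
    exact hw

theorem evenPart_sub_two_mul_mem_succ
    (hΓ : ∀ u ∈ Γ, ∀ q : Q, Commute (evenPart u) q) {k : ℕ} (hk : (2 * k : Q) = 1)
    (hnil : ∀ u ∈ Γ, IsNilpotent (evenPart u - 2))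
    {u : Qˣ} (hu : u ∈ Γ) {n : ℕ} {w : Q}
    (hw : w ∈ lieSeries Γ (n + 1)) : (evenPart u - 2) * w ∈ lieSeries Γ (n + 2) :=
  evenPart_sub_two_mul_mem hΓ hk hnil hu
    (anticomm_mul_mem_succ hΓ hk (oddPart_mem_lieSeries hu) (oddPart_mem_lieSeries hu) n w hw)

/-- In the addition formula the defects from additivity are the bracket and the two products with an
even part minus 2, all of which gain one step of depth. -/
theorem oddPart_mul_sub_sub_mem
    (hΓ : ∀ u ∈ Γ, ∀ q : Q, Commute (evenPart u) q) {k : ℕ} (hk : (2 * k : Q) = 1)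
    (hnil : ∀ u ∈ Γ, IsNilpotent (evenPart u - 2))
    {u z : Qˣ} (hu : u ∈ Γ) (hz : z ∈ Γ) {n : ℕ}
    (hzn : oddPart z ∈ lieSeries Γ (n + 1)) :
    oddPart u + oddPart z - oddPart (u * z) ∈ lieSeries Γ (n + 2) := by
  have hu0 := oddPart_mem_lieSeries hu
  have hz0 := oddPart_mem_lieSeries hz
  have h1 : ⁅oddPart u, oddPart z⁆ ∈ lieSeries Γ (n + 2) := lie_mem_lieSeries hu0 hzn
  have h2 := evenPart_sub_two_mul_mem_succ hΓ hk hnil hu hzn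
  -- Here `oddPart u` has no depth of its own. The triple product formula trades {z, z}u for {z, u}z
  -- (odd parts understood), in which the last factor is deep.
  have h3 : (evenPart z - 2) * oddPart u ∈ lieSeries Γ (n + 2) := by
    refine evenPart_sub_two_mul_mem hΓ hk hnil hz ?_
    have h4 := anticomm_mul_mem_succ hΓ hk hz0 hu0 n _ hzn
    have h5 := lieSeries_succ_le _ (anticomm_mul_sub_mem hΓ hk hz0 hu0 hzn)
    convert AddSubgroup.sub_mem _ h4 h5 using 1
    abel
  refine AddSubgroup.mem_of_two_pow_mul_mem hk 2 ?_
  have h6 : 2 ^ 2 * (oddPart u + oddPart z - oddPart (u * z)) =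
      -(⁅oddPart u, oddPart z⁆ + ((evenPart u - 2) * oddPart z + (evenPart u - 2) * oddPart z)
        + ((evenPart z - 2) * oddPart u + (evenPart z - 2) * oddPart u)) := by
    have h7 := four_oddPart_mul (hΓ u hu) (hΓ z hz)
    have h8 : 2 ^ 2 * (oddPart u + oddPart z - oddPart (u * z)) =
      4 * oddPart u + 4 * oddPart z - 4 * oddPart (u * z) := by noncomm_ring
    rw [h8, h7]
    noncomm_ring
  rw [h6]
  exact AddSubgroup.neg_mem _ (AddSubgroup.add_mem _ (AddSubgroup.add_mem _ h1
    (AddSubgroup.add_mem _ h2 h2)) (AddSubgroup.add_mem _ h3 h3))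

/-- In the expansion of 16 times the odd part of the commutator, replacing even parts by 2 in the
leading term leaves 8 times the bracket. Every error has depth n + 2, and dividing by 8 gives the
claim. -/
theorem two_oddPart_commutator_sub_mem
    (hΓ : ∀ u ∈ Γ, ∀ q : Q, Commute (evenPart u) q) {k : ℕ} (hk : (2 * k : Q) = 1)
    (hnil : ∀ u ∈ Γ, IsNilpotent (evenPart u - 2))
    {u v : Qˣ} (hu : u ∈ Γ) (hv : v ∈ Γ) {n : ℕ}
    (hvn : oddPart v ∈ lieSeries Γ n) :
    oddPart (u * v * u⁻¹ * v⁻¹) + oddPart (u * v * u⁻¹ * v⁻¹) - ⁅oddPart u, oddPart v⁆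
      ∈ lieSeries Γ (n + 2) := by
  have hu0 := oddPart_mem_lieSeries hu
  have hv0 := oddPart_mem_lieSeries hv
  have hW : ⁅oddPart u, oddPart v⁆ ∈ lieSeries Γ (n + 1) := lie_mem_lieSeries hu0 hvn
  have hW' : ⁅oddPart v, oddPart u⁆ ∈ lieSeries Γ (n + 1) := by
    rw [show ⁅oddPart v, oddPart u⁆ = -⁅oddPart u, oddPart v⁆ by
      simp only [Ring.lie_def]; abel]
    exact AddSubgroup.neg_mem _ hW
  have h := oddPart_commutator_eq (eq_zero_of_add_self_eq_zero hk) (hΓ u hu) (hΓ v hv)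
    (anticomm_central hΓ hu0 hv0) (anticomm_central hΓ hu0 hu0) (anticomm_central hΓ hv0 hv0)
  have h1 := evenPart_sub_two_mul_mem_succ hΓ hk hnil hv hW
  have h2 := evenPart_sub_two_mul_mem_succ hΓ hk hnil hu
    (evenPart_mul_mem_lieSeries hΓ hv _ _ hW)
  have h3 := anticomm_mul_mem_succ hΓ hk hu0 hv0 n _ hW
  have h4 := evenPart_mul_mem_lieSeries hΓ hu _ _ (lie_mem_lieSeries hv0 hW)
  have h5 := evenPart_mul_mem_lieSeries hΓ hv _ _ (lie_mem_lieSeries hu0 hW')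
  refine AddSubgroup.mem_of_two_pow_mul_mem hk 3 ?_
  set W := ⁅oddPart u, oddPart v⁆
  set w := oddPart (u * v * u⁻¹ * v⁻¹)
  have h6 : 2 ^ 3 * (w + w - W) = 2 • ((evenPart u - 2) * (evenPart v * W))
      + 4 • ((evenPart v - 2) * W) + anticomm (oddPart u) (oddPart v) * W
      + evenPart u * ⁅oddPart v, W⁆ - evenPart v * ⁅oddPart u, ⁅oddPart v, oddPart u⁆⁆ := by
    have h7 : 2 ^ 3 * (w + w - W) = 16 * w - 8 * W := by noncomm_ring
    rw [h7, h]
    noncomm_ring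
  rw [h6]
  exact AddSubgroup.sub_mem _ (AddSubgroup.add_mem _ (AddSubgroup.add_mem _ (AddSubgroup.add_mem _
    (AddSubgroup.nsmul_mem _ h2 2) (AddSubgroup.nsmul_mem _ h1 4)) h3) h4) h5

/-- Brackets of odd parts are, up to the next term, doubles of odd parts of group commutators. Hence
each graded piece is generated by odd parts of group elements, although L itself was built
additively. -/
theorem lieSeries_le_closure_sup
    (hΓ : ∀ u ∈ Γ, ∀ q : Q, Commute (evenPart u) q) {k : ℕ} (hk : (2 * k : Q) = 1)
    (hnil : ∀ u ∈ Γ, IsNilpotent (evenPart u - 2))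
    (n : ℕ) : lieSeries Γ n ≤
    AddSubgroup.closure (oddPart '' (Γ : Set Qˣ) ∩ lieSeries Γ n) ⊔ lieSeries Γ (n + 1) := by
  induction n with
  | zero =>
    refine le_trans ((AddSubgroup.closure_le _).2 fun z hz => ?_) le_sup_left
    obtain ⟨u, hu, rfl⟩ := hz
    exact AddSubgroup.subset_closure ⟨⟨u, hu, rfl⟩, oddPart_mem_lieSeries hu⟩
  | succ n ih =>
    refine (AddSubgroup.closure_le _).2 ?_
    rintro _ ⟨x, hx, y, hy, rfl⟩
    set N := AddSubgroup.closure (oddPart '' (Γ : Set Qˣ) ∩ lieSeries Γ (n + 1)) ⊔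
      lieSeries Γ (n + 1 + 1) with hN
    obtain ⟨y₁, hy₁, y₂, hy₂, rfl⟩ := AddSubgroup.mem_sup.1 (ih hy)
    rw [show ⁅x, y₁ + y₂⁆ = ⁅x, y₁⁆ + ⁅x, y₂⁆ by simp only [Ring.lie_def]; noncomm_ring]
    refine N.add_mem ?_ (AddSubgroup.mem_sup_right (lie_mem_lieSeries hx hy₂))
    refine lie_mem_of_mem_closure ?_ hx hy₁
    rintro _ ⟨u, hu, rfl⟩ _ ⟨⟨v, hv, rfl⟩, hvn⟩
    have h := two_oddPart_commutator_sub_mem hΓ hk hnil hu hv hvn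
    have hW : ⁅oddPart u, oddPart v⁆ ∈ lieSeries Γ (n + 1) :=
      lie_mem_lieSeries (oddPart_mem_lieSeries hu) hvn
    set w := u * v * u⁻¹ * v⁻¹ with hw
    have hwΓ : w ∈ Γ := Γ.mul_mem (Γ.mul_mem (Γ.mul_mem hu hv) (Γ.inv_mem hu)) (Γ.inv_mem hv)
    have hwn : oddPart w ∈ lieSeries Γ (n + 1) := by
      refine AddSubgroup.mem_of_add_self_mem hk ?_
      simpa using AddSubgroup.add_mem _ (lieSeries_succ_le _ h) hW
    have hwN : oddPart w ∈ N :=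
      AddSubgroup.mem_sup_left (AddSubgroup.subset_closure ⟨⟨w, hwΓ, rfl⟩, hwn⟩)
    have h' : oddPart w + oddPart w - ⁅oddPart u, oddPart v⁆ ∈ N :=
      AddSubgroup.mem_sup_right h
    simpa using N.sub_mem (N.add_mem hwN hwN) h'

theorem exists_oddPart_add_sub_mem_succ
    (hΓ : ∀ u ∈ Γ, ∀ q : Q, Commute (evenPart u) q) {k : ℕ} (hk : (2 * k : Q) = 1)
    (hnil : ∀ u ∈ Γ, IsNilpotent (evenPart u - 2))
    {n : ℕ} {z : Q} (hz : z ∈ lieSeries Γ (n + 1)) {u : Qˣ}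
    (hu : u ∈ Γ) : ∃ v ∈ Γ, oddPart u + z - oddPart v ∈ lieSeries Γ (n + 2) := by
  obtain ⟨y, hy, e, he, rfl⟩ :=
    AddSubgroup.mem_sup.1 (lieSeries_le_closure_sup hΓ hk hnil (n + 1) hz)
  -- Both signs are carried along so that the negation case of the closure induction merely
  -- exchanges them.
  suffices h : (∀ u ∈ Γ, ∃ v ∈ Γ, oddPart u + y - oddPart v ∈ lieSeries Γ (n + 2)) ∧
      ∀ u ∈ Γ, ∃ v ∈ Γ, oddPart u + -y - oddPart v ∈ lieSeries Γ (n + 2) by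
    obtain ⟨v, hv, hmem⟩ := h.1 u hu
    refine ⟨v, hv, ?_⟩
    convert AddSubgroup.add_mem _ hmem he using 1
    abel
  clear hz hu
  induction hy using AddSubgroup.closure_induction with
  | mem y hy =>
    obtain ⟨⟨w, hw, rfl⟩, hwn⟩ := hy
    refine ⟨fun u hu => ⟨u * w, Γ.mul_mem hu hw, oddPart_mul_sub_sub_mem hΓ hk hnil hu hw hwn⟩,
      fun u hu => ⟨u * w⁻¹, Γ.mul_mem hu (Γ.inv_mem hw), ?_⟩⟩
    rw [← oddPart_inv]
    refine oddPart_mul_sub_sub_mem hΓ hk hnil hu (Γ.inv_mem hw) ?_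
    rw [oddPart_inv]
    exact AddSubgroup.neg_mem _ hwn
  | zero => exact ⟨fun u hu => ⟨u, hu, by simp⟩, fun u hu => ⟨u, hu, by simp⟩⟩
  | add x y _ _ h1 h2 =>
    constructor
    · intro u hu
      obtain ⟨v, hv, hv'⟩ := h1.1 u hu
      obtain ⟨w, hw, hw'⟩ := h2.1 v hv
      refine ⟨w, hw, ?_⟩
      convert AddSubgroup.add_mem _ hv' hw' using 1
      abel
    · intro u hu
      obtain ⟨v, hv, hv'⟩ := h1.2 u hu
      obtain ⟨w, hw, hw'⟩ := h2.2 v hv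
      refine ⟨w, hw, ?_⟩
      convert AddSubgroup.add_mem _ hv' hw' using 1
      abel
  | neg x _ h => exact ⟨h.2, by simpa using h.1⟩

theorem exists_oddPart_add_sub_mem
    (hΓ : ∀ u ∈ Γ, ∀ q : Q, Commute (evenPart u) q) {k : ℕ} (hk : (2 * k : Q) = 1)
    (hnil : ∀ u ∈ Γ, IsNilpotent (evenPart u - 2))
    {z : Q} (hz : z ∈ lieSeries Γ 1) (n : ℕ) {u : Qˣ}
    (hu : u ∈ Γ) : ∃ v ∈ Γ, oddPart u + z - oddPart v ∈ lieSeries Γ (n + 1) := by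
  induction n with
  | zero => exact ⟨u, hu, by simpa using hz⟩
  | succ n ih =>
    obtain ⟨v, hv, hv'⟩ := ih
    obtain ⟨w, hw, hw'⟩ := exists_oddPart_add_sub_mem_succ hΓ hk hnil hv' hv
    exact ⟨w, hw, by simpa using hw'⟩

/-! ### Nilpotent radical: termination and injectivity -/

section Nilpotent

variable {J : Ideal Q}

theorem evenPart_sub_two_mem {u : Qˣ} (hu : (u : Q) - 1 ∈ J) : evenPart u - 2 ∈ J := by
  have h : evenPart u - 2 = ↑u⁻¹ * (((u : Q) - 1) * ((u : Q) - 1)) := by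
    have : (↑u⁻¹ : Q) * (((u : Q) - 1) * ((u : Q) - 1))
        = (↑u⁻¹ * u) * u - (↑u⁻¹ * u) - (↑u⁻¹ * u) + ↑u⁻¹ := by noncomm_ring
    rw [this, Units.inv_mul, evenPart, one_mul, ← one_add_one_eq_two]
    abel
  rw [h]
  exact J.mul_mem_left _ (J.mul_mem_left _ hu)

theorem oddPart_mem_ideal {u : Qˣ} (hu : (u : Q) - 1 ∈ J) : oddPart u ∈ J := by
  have h : oddPart u = ((u : Q) - 1) + ↑u⁻¹ * ((u : Q) - 1) := by
    rw [mul_sub, Units.inv_mul, oddPart, mul_one]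
    abel
  rw [h]
  exact J.add_mem hu (J.mul_mem_left _ hu)

theorem isNilpotent_of_mem_of_isNilpotent (hJ : IsNilpotent J) {x : Q} (hx : x ∈ J) :
    IsNilpotent x := by
  obtain ⟨N, hN⟩ := hJ
  refine ⟨N, ?_⟩
  have := Ideal.pow_mem_pow hx N
  rw [hN] at this
  simpa using this

theorem lieSeries_le_pow (hΓJ : ∀ u ∈ Γ, (u : Q) - 1 ∈ J) (n : ℕ) :
    ∀ z ∈ lieSeries Γ n, z ∈ J ^ (n + 1) := by
  have h0 : ∀ z ∈ lieSeries Γ 0, z ∈ J := by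
    intro z hz
    refine (AddSubgroup.closure_le J.toAddSubgroup).2 ?_ hz
    rintro _ ⟨u, hu, rfl⟩
    exact oddPart_mem_ideal (hΓJ u hu)
  induction n with
  | zero => simpa [Submodule.pow_one] using h0
  | succ n ih =>
    intro z hz
    refine (AddSubgroup.closure_le (J ^ (n + 1 + 1)).toAddSubgroup).2 ?_ hz
    rintro _ ⟨x, hx, y, hy, rfl⟩
    rw [Ring.lie_def]
    refine Ideal.sub_mem _ ?_ ?_
    · rw [Submodule.pow_succ' _ n.succ_ne_zero]
      exact Ideal.mul_mem_mul (h0 x hx) (ih y hy)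
    · rw [Submodule.pow_succ]
      exact Ideal.mul_mem_mul (ih y hy) (h0 x hx)

/-- The set of odd parts of a group `Γ` with central even parts, residually trivial modulo a
nilpotent ideal, is stable under translation by the derived Lie ring. -/
theorem exists_oddPart_eq_add (hΓ : ∀ u ∈ Γ, ∀ q : Q, Commute (evenPart u) q) {k : ℕ}
    (hk : (2 * k : Q) = 1) (hJ : IsNilpotent J) (hΓJ : ∀ u ∈ Γ, (u : Q) - 1 ∈ J) {z : Q}
    (hz : z ∈ lieSeries Γ 1) {u : Qˣ} (hu : u ∈ Γ) : ∃ v ∈ Γ, oddPart v = oddPart u + z := by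
  obtain ⟨N, hN⟩ := id hJ
  obtain ⟨v, hv, hv'⟩ := exists_oddPart_add_sub_mem hΓ hk
    (fun u hu => isNilpotent_of_mem_of_isNilpotent hJ (evenPart_sub_two_mem (hΓJ u hu))) hz N hu
  have h := lieSeries_le_pow hΓJ _ _ hv'
  rw [Submodule.pow_succ, Submodule.pow_succ, hN] at h
  exact ⟨v, hv, (sub_eq_zero.1 (by simpa using h)).symm⟩

/-- Equal odd parts force equal squares of even parts. The sum of the even parts is 4 plus a
nilpotent, hence a unit, so the even parts agree too; and u is half the sum of its two parts. -/
theorem oddPart_injOn (hΓ : ∀ u ∈ Γ, ∀ q : Q, Commute (evenPart u) q) {k : ℕ}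
    (hk : (2 * k : Q) = 1) (hJ : IsNilpotent J) (hΓJ : ∀ u ∈ Γ, (u : Q) - 1 ∈ J) :
    Set.InjOn oddPart (Γ : Set Qˣ) := by
  intro u hu v hv huv
  have h2 : IsUnit (2 : Q) :=
    isUnit_iff_exists.2 ⟨k, hk, by rw [(Nat.cast_commute k (2 : Q)).eq, hk]⟩
  have h4 : IsUnit (4 : Q) := by
    rw [show (4 : Q) = 2 * 2 by norm_num]; exact h2.mul h2
  have hsum : IsUnit (evenPart u + evenPart v) := by
    have hn : IsNilpotent ((evenPart u - 2) + (evenPart v - 2)) :=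
      isNilpotent_of_mem_of_isNilpotent hJ
        (J.add_mem (evenPart_sub_two_mem (hΓJ u hu)) (evenPart_sub_two_mem (hΓJ v hv)))
    have := hn.isUnit_add_left_of_commute h4 (by
      exact (((hΓ u hu 4).sub_left (Commute.ofNat_left 2 4)).add_left
        ((hΓ v hv 4).sub_left (Commute.ofNat_left 2 4))))
    convert this using 1
    rw [show (4 : Q) = 2 + 2 by norm_num]
    abel
  have hprod : (evenPart u + evenPart v) * (evenPart u - evenPart v) = 0 := by
    have : (evenPart u + evenPart v) * (evenPart u - evenPart v) = evenPart u * evenPart u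
        - evenPart v * evenPart v + (evenPart v * evenPart u - evenPart u * evenPart v) := by
      noncomm_ring
    rw [this, (hΓ v hv (evenPart u)).eq, evenPart_mul_self_sub, evenPart_mul_self_sub, huv]
    abel
  have heven : evenPart u = evenPart v := sub_eq_zero.1 (hsum.mul_right_eq_zero.1 hprod)
  have : (2 : Q) * u = 2 * v := by
    have h : ∀ w : Qˣ, (2 : Q) * w = evenPart w + oddPart w := by
      intro w
      rw [evenPart, oddPart]
      noncomm_ring
    rw [h, h, heven, huv]
  exact Units.ext (h2.mul_left_cancel this)

end Nilpotent

end PinkSeries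

/-! ### Generalized matrix algebras -/

namespace GMA

section Basic

variable {A B C : Type*} [CommRing A] [AddCommGroup B] [Module A B] [AddCommGroup C] [Module A C]
  {R : GMA A B C}

theorem tr_add (x y : R.Alg) : tr (x + y) = tr x + tr y := by
  simp only [tr, e₁₁_add, e₂₂_add]; ring

theorem tr_smul (a : A) (x : R.Alg) : tr (a • x) = a * tr x := by
  simp only [tr, e₁₁_smul, e₂₂_smul]; ring

/-- The trace as a linear map. -/
def trₗ (R : GMA A B C) : R.Alg →ₗ[A] A where
  toFun := tr
  map_add' := tr_add
  map_smul' := tr_smul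

theorem tr_sub (x y : R.Alg) : tr (x - y) = tr x - tr y := map_sub (trₗ R) x y

theorem tr_zero : tr (0 : R.Alg) = 0 := map_zero (trₗ R)

theorem tr_nsmul (n : ℕ) (x : R.Alg) : tr (n • x) = n • tr x := map_nsmul (trₗ R) n x

theorem tr_mul_comm (x y : R.Alg) : tr (x * y) = tr (y * x) := by
  simp only [tr, e₁₁_mul, e₂₂_mul]; ring

theorem m_mul_m_comm (b b' : B) (c c' : C) : R.m b c * R.m b' c' = R.m b' c * R.m b c' := by
  have := congrArg (fun z => R.m z c') (R.assoc_left b b' c)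
  simpa using this

theorem det_mul (x y : R.Alg) : det (x * y) = det x * det y := by
  simp only [det, e₁₁_mul, e₁₂_mul, e₂₁_mul, e₂₂_mul, map_add, map_smul, LinearMap.add_apply,
    LinearMap.smul_apply, smul_eq_mul]
  have h := m_mul_m_comm (R := R) (e₁₂ x) (e₁₂ y) (e₂₁ x) (e₂₁ y)
  linear_combination -h

theorem det_one : det (1 : R.Alg) = 1 := by
  simp [det, e₁₁_one, e₂₂_one, e₁₂_one]

theorem det_one_add (x : R.Alg) : det (1 + x) = 1 + tr x + det x := by
  simp only [det, tr, e₁₁_add, e₂₂_add, e₁₂_add, e₂₁_add, e₁₁_one, e₂₂_one, e₁₂_one, e₂₁_one,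
    zero_add]
  ring

theorem e₁₁_sub (x y : R.Alg) : e₁₁ (x - y) = e₁₁ x - e₁₁ y := rfl
theorem e₁₂_sub (x y : R.Alg) : e₁₂ (x - y) = e₁₂ x - e₁₂ y := rfl
theorem e₂₁_sub (x y : R.Alg) : e₂₁ (x - y) = e₂₁ x - e₂₁ y := rfl
theorem e₂₂_sub (x y : R.Alg) : e₂₂ (x - y) = e₂₂ x - e₂₂ y := rfl

/-- The Cayley–Hamilton identity. -/
theorem mul_tr_sub_self (x : R.Alg) : x * (tr x • 1 - x) = det x • 1 := by
  apply alg_ext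
  · simp only [e₁₁_mul, e₁₁_sub, e₂₁_sub, e₁₁_smul, e₂₁_smul, e₁₁_one, e₂₁_one, tr, det,
      smul_zero, zero_sub, map_neg]
    ring
  · simp only [e₁₂_mul, e₁₂_sub, e₂₂_sub, e₁₂_smul, e₂₂_smul, e₁₂_one, e₂₂_one, tr,
      smul_zero, zero_sub]
    module
  · simp only [e₂₁_mul, e₁₁_sub, e₂₁_sub, e₁₁_smul, e₂₁_smul, e₂₁_one, e₁₁_one, tr,
      smul_zero, zero_sub]
    module
  · simp only [e₂₂_mul, e₁₂_sub, e₂₂_sub, e₁₂_smul, e₂₂_smul, e₁₂_one, e₂₂_one, tr, det,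
      smul_zero, zero_sub, map_neg, LinearMap.neg_apply]
    ring

theorem tr_sub_self_mul (x : R.Alg) : (tr x • 1 - x) * x = det x • 1 := by
  rw [← mul_tr_sub_self, sub_mul, mul_sub]
  simp

theorem two_mul_det (x : R.Alg) : 2 * det x = tr x * tr x - tr (x * x) := by
  simp only [tr, det, e₁₁_mul, e₂₂_mul]; ring

theorem isUnit_of_isUnit_det {x : R.Alg} (h : IsUnit (det x)) : IsUnit x := by
  obtain ⟨u, hu⟩ := h
  refine isUnit_iff_exists.2 ⟨(↑u⁻¹ : A) • (tr x • 1 - x), ?_, ?_⟩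
  · rw [mul_smul_comm, mul_tr_sub_self, ← hu, smul_smul, Units.inv_mul, one_smul]
  · rw [smul_mul_assoc, tr_sub_self_mul, ← hu, smul_smul, Units.inv_mul, one_smul]

theorem coe_inv_eq_of_det_eq_one {u : R.Algˣ} (h : det (u : R.Alg) = 1) :
    ((u⁻¹ : R.Algˣ) : R.Alg) = tr (u : R.Alg) • 1 - (u : R.Alg) := by
  refine Units.inv_eq_of_mul_eq_one_right ?_
  rw [mul_tr_sub_self, h, one_smul]

theorem isUnit_one_add_of_forall_mem {a : A} (h : ∀ 𝔪 : MaximalSpectrum A, a ∈ 𝔪.asIdeal) :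
    IsUnit (1 + a) := by
  by_contra hn
  obtain ⟨M, hM, hmem⟩ := exists_max_ideal_of_mem_nonunits hn
  have := M.sub_mem hmem (h ⟨M, hM⟩)
  rw [add_sub_cancel_right] at this
  exact hM.ne_top ((Ideal.eq_top_iff_one M).2 this)

theorem forall_mem_of_isUnit_one_add {a : A} (h : ∀ c, IsUnit (1 + c * a)) :
    ∀ 𝔪 : MaximalSpectrum A, a ∈ 𝔪.asIdeal := by
  intro 𝔪
  by_contra hn
  obtain ⟨c, hc⟩ := Ideal.IsMaximal.exists_inv 𝔪.isMaximal hn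
  obtain ⟨i, hi, hci⟩ := hc
  have h1 : 1 + -c * a = i := by rw [← hci]; ring
  exact 𝔪.isMaximal.ne_top (Ideal.eq_top_of_isUnit_mem _ hi (h1 ▸ h (-c)))

/-- The determinant of 1 + xy is 1 modulo every maximal ideal, hence a unit, and Cayley–Hamilton
then inverts 1 + xy. -/
theorem mem_jacobson_of_forall_mem {y : R.Alg}
    (htr : ∀ (x : R.Alg) (𝔪 : MaximalSpectrum A), tr (x * y) ∈ 𝔪.asIdeal)
    (hdet : ∀ 𝔪 : MaximalSpectrum A, det y ∈ 𝔪.asIdeal) : y ∈ Ring.jacobson R.Alg := by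
  rw [← Ideal.jacobson_bot, Ideal.mem_jacobson_iff]
  intro x
  have hu : IsUnit (1 + x * y) := by
    apply isUnit_of_isUnit_det
    rw [det_one_add, add_assoc]
    refine isUnit_one_add_of_forall_mem fun 𝔪 => 𝔪.asIdeal.add_mem (htr x 𝔪) ?_
    rw [det_mul]
    exact 𝔪.asIdeal.mul_mem_left _ (hdet 𝔪)
  obtain ⟨z, -, hz⟩ := isUnit_iff_exists.1 hu
  refine ⟨z, ?_⟩
  rw [mul_add, mul_one] at hz
  rw [Ideal.mem_bot, ← hz]
  noncomm_ring

theorem isUnit_det_of_mem_jacobson {y : R.Alg} (hy : y ∈ Ring.jacobson R.Alg) (x : R.Alg) :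
    IsUnit (det (1 + x * y)) := by
  rw [← Ideal.jacobson_bot, Ideal.mem_jacobson_iff] at hy
  obtain ⟨z, hz⟩ := hy x
  have h : z * (1 + x * y) = 1 := by
    rw [Ideal.mem_bot, sub_eq_zero] at hz
    rw [mul_add, mul_one, add_comm, ← mul_assoc, hz]
  have h' := congrArg det h
  rw [det_mul, det_one] at h'
  exact IsUnit.of_mul_eq_one_right _ h'

/-- Multiplying y by elements with a single nonzero entry makes det(1 + xy) equal to 1 plus a
multiple of one diagonal entry, or of the product of the off-diagonal entries. -/
theorem tr_mem_and_det_mem_of_mem_jacobson {y : R.Alg} (hy : y ∈ Ring.jacobson R.Alg)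
    (𝔪 : MaximalSpectrum A) : tr y ∈ 𝔪.asIdeal ∧ det y ∈ 𝔪.asIdeal := by
  have h₁ : e₁₁ y ∈ 𝔪.asIdeal := by
    refine forall_mem_of_isUnit_one_add (fun c => ?_) 𝔪
    convert isUnit_det_of_mem_jacobson hy (ofEntries c 0 0 0) using 1
    rw [det_one_add, tr, det, e₁₁_mul, e₂₂_mul, e₂₁_mul]
    simp [ofEntries, e₁₁, e₁₂, e₂₁, e₂₂]
  have h₂ : e₂₂ y ∈ 𝔪.asIdeal := by
    refine forall_mem_of_isUnit_one_add (fun c => ?_) 𝔪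
    convert isUnit_det_of_mem_jacobson hy (ofEntries 0 0 0 c) using 1
    rw [det_one_add, tr, det, e₁₁_mul, e₂₂_mul, e₁₂_mul]
    simp [ofEntries, e₁₁, e₁₂, e₂₁, e₂₂]
  have h₃ : R.m (e₁₂ y) (e₂₁ y) ∈ 𝔪.asIdeal := by
    refine forall_mem_of_isUnit_one_add (fun c => ?_) 𝔪
    convert isUnit_det_of_mem_jacobson hy (ofEntries 0 (c • e₁₂ y) 0 0) using 1
    rw [det_one_add, tr, det, e₁₁_mul, e₂₂_mul, e₂₁_mul]
    simp [ofEntries, e₁₁, e₁₂, e₂₁, e₂₂]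
  exact ⟨𝔪.asIdeal.add_mem h₁ h₂, 𝔪.asIdeal.sub_mem (𝔪.asIdeal.mul_mem_left _ h₂) h₃⟩

/-- The two-sided ideal of the `y` such that `tr (x y) ∈ I` for all `x`. -/
def traceIdeal (R : GMA A B C) (I : Ideal A) : Ideal R.Alg where
  carrier := {y | ∀ x : R.Alg, tr (x * y) ∈ I}
  zero_mem' := fun x => by rw [mul_zero, tr_zero]; exact I.zero_mem
  add_mem' := fun hy hz x => by rw [mul_add, tr_add]; exact I.add_mem (hy x) (hz x)
  smul_mem' := fun c y hy x => by rw [smul_eq_mul, ← mul_assoc]; exact hy _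

instance traceIdeal_isTwoSided (I : Ideal A) : (R.traceIdeal I).IsTwoSided where
  mul_mem_of_left := fun {y} z hy x => by
    rw [← mul_assoc, tr_mul_comm, ← mul_assoc]
    exact hy _

theorem traceIdeal_mono {I I' : Ideal A} (h : I ≤ I') : R.traceIdeal I ≤ R.traceIdeal I' :=
  fun _ hy x => h (hy x)

theorem smul_mem_traceIdeal {I : Ideal A} {a : A} (ha : a ∈ I) (y : R.Alg) :
    a • y ∈ R.traceIdeal I := fun x => by
  rw [mul_smul_comm, tr_smul]
  exact I.mul_mem_right _ ha

theorem mem_traceIdeal_of_span {PG : Type*} {ρ : PG → R.Alg}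
    (hρ : Submodule.span A (Set.range ρ) = ⊤) {I : Ideal A} {y : R.Alg}
    (h : ∀ g, tr (ρ g * y) ∈ I) : y ∈ R.traceIdeal I := by
  intro x
  have hx : x ∈ Submodule.span A (Set.range ρ) := hρ ▸ Submodule.mem_top
  induction hx using Submodule.span_induction with
  | mem x hx => obtain ⟨g, rfl⟩ := hx; exact h g
  | zero => rw [zero_mul, tr_zero]; exact I.zero_mem
  | add x z _ _ h1 h2 => rw [add_mul, tr_add]; exact I.add_mem h1 h2
  | smul a x _ h1 => rw [smul_mul_assoc, tr_smul]; exact I.mul_mem_left _ h1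

end Basic

end GMA

namespace GMA

/-! ### Trace ideals and the module topology -/

section ModuleTopology

variable {A B C : Type*} [CommRing A] [AddCommGroup B] [Module A B] [AddCommGroup C]
  [Module A C] {R : GMA A B C} [TopologicalSpace A] [IsTopologicalRing A]

/-- Scalars in I kill the quotient, so A acts continuously on it with the discrete topology. The
module topology then makes the linear quotient map continuous. -/
theorem isOpen_traceIdeal {I : Ideal A} (hI : IsOpen (I : Set A)) : IsOpen (R.traceIdeal I : Set R.Alg) := by
  have hmt : IsModuleTopology A R.Alg := ⟨rfl⟩
  let τ : TopologicalSpace (R.Alg ⧸ R.traceIdeal I) := ⊥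
  have hdisc : DiscreteTopology (R.Alg ⧸ R.traceIdeal I) := ⟨rfl⟩
  have hsmul : ContinuousSMul A (R.Alg ⧸ R.traceIdeal I) := by
    refine ⟨continuous_prod_of_discrete_right.2 fun q => ?_⟩
    refine continuous_discrete_rng.2 fun q' => ?_
    rw [isOpen_iff_mem_nhds]
    intro a ha
    have hc : Continuous fun b : A => b - a := by fun_prop
    filter_upwards [(hI.preimage hc).mem_nhds (by simp)] with b hb
    obtain ⟨y, rfl⟩ := Ideal.Quotient.mk_surjective q
    rw [Set.mem_preimage, Set.mem_singleton_iff] at ha ⊢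
    rw [← ha, ← sub_eq_zero]
    change b • _ - a • _ = _
    rw [← sub_smul]
    exact Ideal.Quotient.eq_zero_iff_mem.2 (smul_mem_traceIdeal hb y)
  let f : R.Alg →ₗ[A] R.Alg ⧸ R.traceIdeal I := (R.traceIdeal I).mkQ.restrictScalars A
  have hf : Continuous f := IsModuleTopology.continuous_of_linearMap f
  have : (R.traceIdeal I : Set R.Alg) = f ⁻¹' {0} := by
    ext y
    simp only [Set.mem_preimage, Set.mem_singleton_iff, SetLike.mem_coe]
    exact (Submodule.Quotient.mk_eq_zero _).symm
  rw [this]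
  exact (isOpen_discrete _).preimage hf

/-- Topological closures disappear modulo an open ideal, so L and L₂ reduce to the algebraic objects
of the finite quotient. -/
theorem mk_mem_closure_of_mem_closedAddSpan {I : Ideal A} (hI : IsOpen (I : Set A)) {X : Set R.Alg} {x : R.Alg}
    (hx : x ∈ closedAddSpan X) :
    Ideal.Quotient.mk (R.traceIdeal I) x ∈
      AddSubgroup.closure (Ideal.Quotient.mk (R.traceIdeal I) '' X) := by
  have hmt : IsModuleTopology A R.Alg := ⟨rfl⟩
  have hadd : ContinuousAdd R.Alg := IsModuleTopology.toContinuousAdd A R.Alg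
  have hneg : ContinuousNeg R.Alg := IsModuleTopology.continuousNeg A R.Alg
  have hgrp : IsTopologicalAddGroup R.Alg := {}
  have hnhds : (fun y => y - x) ⁻¹' (R.traceIdeal I : Set R.Alg) ∈ nhds x := by
    have hc : Continuous fun y : R.Alg => y - x := continuous_id.sub continuous_const
    exact ((isOpen_traceIdeal hI).preimage hc).mem_nhds (by simp)
  obtain ⟨y, hy, hyX⟩ := mem_closure_iff_nhds.1 hx _ hnhds
  rw [← Ideal.Quotient.eq.2 hy]
  have := AddSubgroup.mem_map_of_mem (Ideal.Quotient.mk (R.traceIdeal I)).toAddMonoidHom hyX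
  rw [AddMonoidHom.map_closure] at this
  exact this

end ModuleTopology

/-! ### Reductions of ρ and finiteness of the quotients -/

section Reduction

variable {PG A B C : Type*} [Group PG] [CommRing A] [AddCommGroup B] [Module A B] [AddCommGroup C]
  [Module A C] {R : GMA A B C}

/-- The reduction of `ρ` modulo the Jacobson radical. -/
def residualHom (ρ : PG →* R.Algˣ) : PG →* (R.Alg ⧸ Ring.jacobson R.Alg)ˣ :=
  (Units.map (Ideal.Quotient.mk (Ring.jacobson R.Alg)).toMonoidHom).comp ρ

theorem residualImage_eq_range (ρ : PG →* R.Algˣ) : residualImage ρ = (residualHom ρ).range := by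
  rw [residualImage, residualHom, MonoidHom.range_eq_map, MonoidHom.range_eq_map, Subgroup.map_map]

theorem mem_ker_residualHom {ρ : PG →* R.Algˣ} {g : PG} :
    g ∈ (residualHom ρ).ker ↔ (ρ g : R.Alg) - 1 ∈ Ring.jacobson R.Alg := by
  rw [MonoidHom.mem_ker, Units.ext_iff, ← Ideal.Quotient.eq]
  rfl

/-- The reduction of `ρ` modulo the ideal `traceIdeal I`. -/
def traceHom (ρ : PG →* R.Algˣ) (I : Ideal A) : PG →* (R.Alg ⧸ R.traceIdeal I)ˣ :=
  (Units.map (Ideal.Quotient.mk (R.traceIdeal I)).toMonoidHom).comp ρ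

theorem coe_traceHom (ρ : PG →* R.Algˣ) (I : Ideal A) (g : PG) :
    (traceHom ρ I g : R.Alg ⧸ R.traceIdeal I) = Ideal.Quotient.mk (R.traceIdeal I) (ρ g) := rfl

theorem mem_ker_traceHom {ρ : PG →* R.Algˣ} {I : Ideal A} {g : PG} :
    g ∈ (traceHom ρ I).ker ↔ (ρ g : R.Alg) - 1 ∈ R.traceIdeal I := by
  rw [MonoidHom.mem_ker, Units.ext_iff, ← Ideal.Quotient.eq]
  rfl

variable [TopologicalSpace PG] [IsTopologicalGroup PG] [CompactSpace PG] [TopologicalSpace A]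
  [IsTopologicalRing A] {t : PG → A} {d : PG →* Aˣ} {ρ : PG →* R.Algˣ}

/-- Compactness of the group gives uniform continuity: t(hg) ≡ t(h) modulo I for all h once g is
near 1. Since ρ spans R, this puts ρ(g) - 1 in the trace ideal. -/
theorem isOpen_ker_traceHom (ht : Continuous t) (hρ : IsTDRep t d R ρ) {I : Ideal A}
    (hI : IsOpen (I : Set A)) : IsOpen ((traceHom ρ I).ker : Set PG) := by
  refine Subgroup.isOpen_of_mem_nhds (g := 1) _ ?_
  have h := isCompact_univ.eventually_forall_of_forall_eventually (x₀ := (1 : PG))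
    (P := fun g h => t (h * g) - t h ∈ I) (K := (Set.univ : Set PG)) (fun h _ => by
      have hc : Continuous fun z : PG × PG => t (z.2 * z.1) - t z.2 := by fun_prop
      exact (hI.preimage hc).mem_nhds (by simp))
  filter_upwards [h] with g hg
  refine mem_ker_traceHom.2 (mem_traceIdeal_of_span hρ.span_eq_top fun h => ?_)
  rw [mul_sub, mul_one, tr_sub, ← Units.val_mul, ← map_mul, hρ.tr_eq, hρ.tr_eq]
  exact hg h trivial

theorem finite_range_traceHom (ht : Continuous t) (hρ : IsTDRep t d R ρ) {I : Ideal A}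
    (hI : IsOpen (I : Set A)) : Finite (traceHom ρ I).range := by
  have h1 : Finite (PG ⧸ (traceHom ρ I).ker) :=
    Subgroup.quotient_finite_of_isOpen _ (isOpen_ker_traceHom ht hρ hI)
  exact Finite.of_equiv _ (QuotientGroup.quotientKerEquivRange (traceHom ρ I)).toEquiv

/-- The quotient consists of the combinations, with coefficients in the finite ring A/I, of the
finitely many images of group elements. -/
theorem finite_quotient_traceIdeal [CompactSpace A] (ht : Continuous t) (hρ : IsTDRep t d R ρ)
    {I : Ideal A} (hI : IsOpen (I : Set A)) : Finite (R.Alg ⧸ R.traceIdeal I) := by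
  classical
  have hfin := finite_range_traceHom ht hρ hI
  have hAI : Finite (A ⧸ I) := AddSubgroup.quotient_finite_of_isOpen I.toAddSubgroup hI
  let _ : Fintype (traceHom ρ I).range := Fintype.ofFinite _
  let s : A ⧸ I → A := Function.surjInv Ideal.Quotient.mk_surjective
  have hs : ∀ a, a - s (Ideal.Quotient.mk I a) ∈ I := fun a => by
    rw [← Ideal.Quotient.eq]
    exact (Function.surjInv_eq Ideal.Quotient.mk_surjective _).symm
  let f : ((traceHom ρ I).range → A ⧸ I) → R.Alg ⧸ R.traceIdeal I := fun c =>
    ∑ u, s (c u) • (u.1 : R.Alg ⧸ R.traceIdeal I)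
  have hsmul : ∀ a b : A, a - b ∈ I → ∀ q : R.Alg ⧸ R.traceIdeal I, a • q = b • q := by
    intro a b hab q
    obtain ⟨y, rfl⟩ := Ideal.Quotient.mk_surjective q
    rw [← sub_eq_zero, ← sub_smul]
    exact Ideal.Quotient.eq_zero_iff_mem.2 (smul_mem_traceIdeal hab y)
  refine Finite.of_surjective f fun q => ?_
  obtain ⟨y, rfl⟩ := Ideal.Quotient.mk_surjective q
  have hy : y ∈ Submodule.span A (Set.range fun g => (ρ g : R.Alg)) :=
    hρ.span_eq_top ▸ Submodule.mem_top
  have key : ∀ c c' : (traceHom ρ I).range → A ⧸ I, f (c + c') = f c + f c' := by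
    intro c c'
    simp only [f, ← Finset.sum_add_distrib, ← add_smul]
    refine Finset.sum_congr rfl fun u _ => hsmul _ _ ?_ _
    rw [← Ideal.Quotient.eq, map_add]
    simp [s, Function.surjInv_eq]
  have key' : ∀ (a : A) (c : (traceHom ρ I).range → A ⧸ I),
      f (fun u => Ideal.Quotient.mk I a * c u) = a • f c := by
    intro a c
    simp only [f, Finset.smul_sum, smul_smul]
    refine Finset.sum_congr rfl fun u _ => hsmul _ _ ?_ _
    rw [← Ideal.Quotient.eq, map_mul]
    simp [s, Function.surjInv_eq]
  induction hy using Submodule.span_induction with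
  | mem x hx =>
    obtain ⟨g, rfl⟩ := hx
    refine ⟨Pi.single ⟨traceHom ρ I g, g, rfl⟩ 1, ?_⟩
    have : ∀ u : (traceHom ρ I).range, s (Pi.single (M := fun _ => A ⧸ I)
        ⟨traceHom ρ I g, g, rfl⟩ 1 u) • (u.1 : R.Alg ⧸ R.traceIdeal I)
        = if u = ⟨traceHom ρ I g, g, rfl⟩ then (u.1 : R.Alg ⧸ R.traceIdeal I) else 0 := by
      intro u
      split_ifs with h
      · subst h
        rw [Pi.single_eq_same, hsmul _ 1 ?_, one_smul]
        rw [← Ideal.Quotient.eq, map_one]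
        exact Function.surjInv_eq Ideal.Quotient.mk_surjective _
      · rw [Pi.single_eq_of_ne h, hsmul _ 0 ?_, zero_smul]
        rw [← Ideal.Quotient.eq, map_zero]
        exact Function.surjInv_eq Ideal.Quotient.mk_surjective _
    simp only [f, this]
    rw [Finset.sum_ite_eq' Finset.univ]
    simp [coe_traceHom]
  | zero =>
    refine ⟨0, ?_⟩
    have := key 0 0
    rw [add_zero] at this
    rw [map_zero]
    simpa using this
  | add x z _ _ h1 h2 =>
    obtain ⟨c, hc⟩ := h1
    obtain ⟨c', hc'⟩ := h2
    exact ⟨c + c', by rw [key, hc, hc', map_add]⟩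
  | smul a x _ h1 =>
    obtain ⟨c, hc⟩ := h1
    exact ⟨_, by rw [key' a c, hc]; rfl⟩

end Reduction

end GMA

namespace GMA

/-! ### Pink's map and odd parts -/

section Theta

variable {F A B C : Type*} [Field F] [CommRing A] [Algebra F A] [AddCommGroup B] [Module A B]
  [AddCommGroup C] [Module A C] {R : GMA A B C}

theorem tr_mul_pinkTheta {g : R.Alg} (hg : tr g = 0) (x : R.Alg) :
    tr (g * pinkTheta F x) = tr (g * x) := by
  rw [pinkTheta, mul_sub, tr_sub, mul_smul_comm, tr_smul, mul_one, hg, mul_zero, sub_zero]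

theorem pinkTheta_add_self (h2 : (2 : F) ≠ 0) {u : R.Algˣ} (hu : det (u : R.Alg) = 1) :
    pinkTheta F (u : R.Alg) + pinkTheta F (u : R.Alg) = oddPart u := by
  have h : ((2⁻¹ : F) • tr (u : R.Alg)) + ((2⁻¹ : F) • tr (u : R.Alg)) = tr (u : R.Alg) := by
    rw [← add_smul, ← two_mul, mul_inv_cancel₀ h2, one_smul]
  rw [oddPart, coe_inv_eq_of_det_eq_one hu, pinkTheta]
  conv_rhs => rw [← h, add_smul]
  abel

theorem evenPart_eq {u : R.Algˣ} (hu : det (u : R.Alg) = 1) :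
    evenPart u = tr (u : R.Alg) • (1 : R.Alg) := by
  rw [evenPart, coe_inv_eq_of_det_eq_one hu]
  abel

theorem exists_two_mul_natCast_eq_one {p : ℕ} (hp : 2 < p) [Fact p.Prime] {S : Type*} [Ring S]
    (hS : (p : S) = 0) : ∃ k : ℕ, (2 * k : S) = 1 := by
  have hodd : p % 2 = 1 := (Fact.out : p.Prime).eq_two_or_odd.resolve_left (by omega)
  refine ⟨(p + 1) / 2, ?_⟩
  have : 2 * ((p + 1) / 2) = p + 1 := by omega
  have h := congrArg (Nat.cast : ℕ → S) this
  push_cast at h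
  rw [h, hS, zero_add]

variable (F) in
theorem natCast_eq_zero_quotient (p : ℕ) [CharP F p] (I : Ideal A) :
    ((p : ℕ) : R.Alg ⧸ R.traceIdeal I) = 0 := by
  have h : ((p : ℕ) : A) = 0 := by
    rw [← map_natCast (algebraMap F A), CharP.cast_eq_zero, map_zero]
  have h' : ((p : ℕ) : R.Alg) = 0 := by
    rw [← map_natCast (algebraMap A R.Alg), h, map_zero]
  rw [← map_natCast (Ideal.Quotient.mk (R.traceIdeal I)), h', map_zero]

end Theta

section Reduction

variable {p : ℕ} {PG F A B C : Type*} [Group PG] [Field F] [CharP F p] [CommRing A]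
  [Algebra F A] [AddCommGroup B] [Module A B] [AddCommGroup C] [Module A C] {R : GMA A B C}
  {ρ : PG →* R.Algˣ}

/-- The determinant is a constant congruent to 1 modulo a maximal ideal, and nonzero constants are
units. -/
theorem det_eq_one_of_mem_ker_residualHom [Nontrivial A] {g : PG} (hg : g ∈ (residualHom ρ).ker)
    (hd : det (ρ g : R.Alg) ∈ Set.range (algebraMap F A)) : det (ρ g : R.Alg) = 1 := by
  obtain ⟨c, hc⟩ := hd
  obtain ⟨M, hM⟩ := Ideal.exists_maximal A
  have h := tr_mem_and_det_mem_of_mem_jacobson (mem_ker_residualHom.1 hg) ⟨M, hM⟩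
  have hdet : det (ρ g : R.Alg) - 1 ∈ M := by
    have h1 := det_one_add ((ρ g : R.Alg) - 1)
    rw [add_sub_cancel] at h1
    rw [h1]
    convert M.add_mem h.1 h.2 using 1
    ring
  rw [← hc, ← map_one (algebraMap F A), ← map_sub] at hdet
  by_contra hne
  have hc1 : c - 1 ≠ 0 := by
    intro h0
    rw [sub_eq_zero] at h0
    rw [h0, map_one] at hc
    exact hne hc.symm
  exact hM.ne_top (Ideal.eq_top_of_isUnit_mem _ hdet ((IsUnit.mk0 _ hc1).map (algebraMap F A)))

theorem oddPart_map {S S' : Type*} [Ring S] [Ring S'] (f : S →+* S') (u : Sˣ) :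
    oddPart (Units.map f.toMonoidHom u) = f (oddPart u) := by
  simp only [oddPart, map_sub]
  rfl

theorem evenPart_map {S S' : Type*} [Ring S] [Ring S'] (f : S →+* S') (u : Sˣ) :
    evenPart (Units.map f.toMonoidHom u) = f (evenPart u) := by
  simp only [evenPart, map_add]
  rfl

theorem commute_evenPart_of_mem_map
    (hdet : ∀ g ∈ (residualHom ρ).ker, det (ρ g : R.Alg) = 1) {I : Ideal A} :
    ∀ u ∈ (residualHom ρ).ker.map (traceHom ρ I), ∀ q : R.Alg ⧸ R.traceIdeal I,
      Commute (evenPart u) q := by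
  rintro _ ⟨g, hg, rfl⟩ q
  obtain ⟨y, rfl⟩ := Ideal.Quotient.mk_surjective q
  rw [traceHom, MonoidHom.comp_apply, evenPart_map, evenPart_eq (hdet g hg)]
  have : Commute (tr (ρ g : R.Alg) • (1 : R.Alg)) y := (Commute.one_left y).smul_left _
  exact this.map _

theorem sub_one_mem_jacobson_of_mem_map {I : Ideal A} :
    ∀ u ∈ (residualHom ρ).ker.map (traceHom ρ I),
      (u : R.Alg ⧸ R.traceIdeal I) - 1 ∈ Ring.jacobson (R.Alg ⧸ R.traceIdeal I) := by
  rintro _ ⟨g, hg, rfl⟩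
  have h := Ring.le_comap_jacobson (Ideal.Quotient.mk (R.traceIdeal I)) (mem_ker_residualHom.1 hg)
  rw [Ideal.mem_comap, map_sub, map_one] at h
  exact h

theorem oddPart_traceHom
    (hdet : ∀ g ∈ (residualHom ρ).ker, det (ρ g : R.Alg) = 1) (hp : 2 < p)
    {I : Ideal A} {g : PG} (hg : g ∈ (residualHom ρ).ker) :
    oddPart (traceHom ρ I g) = Ideal.Quotient.mk (R.traceIdeal I)
      (pinkTheta F (ρ g : R.Alg) + pinkTheta F (ρ g : R.Alg)) := by
  have h2 : (2 : F) ≠ 0 := by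
    intro h
    have := (CharP.cast_eq_zero_iff F p 2).1 (by exact_mod_cast h)
    exact absurd (Nat.le_of_dvd (by norm_num) this) (by omega)
  rw [pinkTheta_add_self h2 (hdet g hg), traceHom, MonoidHom.comp_apply, oddPart_map]

variable [Fact p.Prime] [TopologicalSpace A] [IsTopologicalRing A]

theorem mk_mem_lieSeries_zero
    (hdet : ∀ g ∈ (residualHom ρ).ker, det (ρ g : R.Alg) = 1) (hp : 2 < p)
    {I : Ideal A} (hI : IsOpen (I : Set A)) {x : R.Alg}
    (hx : x ∈ pinkLie F ρ) :
    Ideal.Quotient.mk (R.traceIdeal I) x ∈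
      lieSeries ((residualHom ρ).ker.map (traceHom ρ I)) 0 := by
  obtain ⟨k, hk⟩ := exists_two_mul_natCast_eq_one hp
    (natCast_eq_zero_quotient (R := R) F p I)
  refine (AddSubgroup.closure_le _).2 ?_ (mk_mem_closure_of_mem_closedAddSpan hI hx)
  rintro _ ⟨_, ⟨_, ⟨⟨g, rfl⟩, hg⟩, rfl⟩, rfl⟩
  have hg' : g ∈ (residualHom ρ).ker := mem_ker_residualHom.2 hg.2
  refine AddSubgroup.mem_of_add_self_mem hk ?_
  rw [← map_add, ← oddPart_traceHom hdet hp hg']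
  exact oddPart_mem_lieSeries ⟨g, hg', rfl⟩

theorem mk_mem_lieSeries_one
    (hdet : ∀ g ∈ (residualHom ρ).ker, det (ρ g : R.Alg) = 1) (hp : 2 < p)
    {I : Ideal A} (hI : IsOpen (I : Set A)) {x : R.Alg}
    (hx : x ∈ pinkLie₂ F ρ) :
    Ideal.Quotient.mk (R.traceIdeal I) x ∈
      lieSeries ((residualHom ρ).ker.map (traceHom ρ I)) 1 := by
  refine (AddSubgroup.closure_le _).2 ?_ (mk_mem_closure_of_mem_closedAddSpan hI hx)
  rintro _ ⟨_, ⟨y, hy, z, hz, rfl⟩, rfl⟩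
  rw [map_sub, map_mul, map_mul]
  exact lie_mem_lieSeries (mk_mem_lieSeries_zero hdet hp hI hy)
    (mk_mem_lieSeries_zero hdet hp hI hz)

/-- If the translates of the image of `M` by the multiples of `x ∈ L₂` are pairwise disjoint, then
the image of `M` has at most `1/p` of the elements of the image of the residual kernel. -/
theorem mul_ncard_traceHom_image_le
    (hdet : ∀ g ∈ (residualHom ρ).ker, det (ρ g : R.Alg) = 1) (hp : 2 < p)
    {I : Ideal A} (hI : IsOpen (I : Set A))
    [Finite (R.Alg ⧸ R.traceIdeal I)] {x : R.Alg} (hx : x ∈ pinkLie₂ F ρ) {M : Set PG}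
    (hM : M ⊆ (residualHom ρ).ker)
    (hdisj : ∀ k : ℕ, 0 < k → k < p → ∀ g ∈ M, ∀ h ∈ M,
      pinkTheta F (ρ g : R.Alg) - pinkTheta F (ρ h : R.Alg) - k • x ∉ R.traceIdeal I) :
    p * (traceHom ρ I '' M).ncard ≤
      (traceHom ρ I '' ((residualHom ρ).ker : Set PG)).ncard := by
  set Γ := (residualHom ρ).ker.map (traceHom ρ I) with hΓdef
  obtain ⟨k, hk⟩ := exists_two_mul_natCast_eq_one hp
    (natCast_eq_zero_quotient (R := R) F p I)
  have hJ : IsNilpotent (Ring.jacobson (R.Alg ⧸ R.traceIdeal I)) := IsSemiprimaryRing.isNilpotent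
  have hΓ := commute_evenPart_of_mem_map hdet (I := I)
  have hΓJ := sub_one_mem_jacobson_of_mem_map (ρ := ρ) (I := I)
  have hinj := oddPart_injOn hΓ hk hJ hΓJ
  have hxL := mk_mem_lieSeries_one hdet hp hI hx
  set q := Ideal.Quotient.mk (R.traceIdeal I) with hq
  -- Odd parts are 2Θ, so translating Θ by i • x means translating the odd part by 2i times x.
  have hex : ∀ (u : traceHom ρ I '' M) (i : Fin p), ∃ v ∈ Γ,
      oddPart v = oddPart u.1 + (2 * i.1) • q x := by
    intro u i
    refine exists_oddPart_eq_add hΓ hk hJ hΓJ (AddSubgroup.nsmul_mem _ hxL _) ?_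
    obtain ⟨u, g, hg, rfl⟩ := u
    exact ⟨g, hM hg, rfl⟩
  choose v hv hvq using hex
  have hne : ∀ (u u' : traceHom ρ I '' M) (i j : Fin p), i < j → v u i ≠ v u' j := by
    rintro ⟨_, g, hg, rfl⟩ ⟨_, h, hh, rfl⟩ i j hij heq
    have h1 := hvq ⟨_, g, hg, rfl⟩ i
    rw [heq, hvq] at h1
    simp only at h1
    rw [oddPart_traceHom (F := F) hdet hp (hM hg), oddPart_traceHom (F := F) hdet hp (hM hh),
      ← hq] at h1
    refine hdisj (j - i) (by have : i.1 < j.1 := hij; omega) (by omega) g hg h hh ?_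
    rw [← Ideal.Quotient.eq_zero_iff_mem, ← hq]
    refine eq_zero_of_add_self_eq_zero hk _ ?_
    have hj : j.1 = (j.1 - i.1) + i.1 := by have : i.1 < j.1 := hij; omega
    rw [hj] at h1
    simp only [map_sub, map_add, map_nsmul] at h1 ⊢
    rw [mul_add, add_smul, mul_smul, two_smul ℕ] at h1
    rw [← sub_eq_zero] at h1
    rw [← neg_eq_zero, ← h1]
    abel
  have hinj' : Function.Injective fun z : (traceHom ρ I '' M) × Fin p =>
      (⟨v z.1 z.2, hv z.1 z.2⟩ : (traceHom ρ I '' ((residualHom ρ).ker : Set PG))) := by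
    rintro ⟨u, i⟩ ⟨u', j⟩ h
    have h' : v u i = v u' j := congrArg Subtype.val h
    rcases lt_trichotomy i j with hij | rfl | hij
    · exact absurd h' (hne _ _ _ _ hij)
    · have h1 := hvq u i
      rw [h', hvq, add_left_inj] at h1
      have h2 : u'.1 = u.1 := by
        obtain ⟨_, g, hg, rfl⟩ := u
        obtain ⟨_, g', hg', rfl⟩ := u'
        exact hinj ⟨g', hM hg', rfl⟩ ⟨g, hM hg, rfl⟩ h1
      rw [Subtype.ext h2]
    · exact absurd h'.symm (hne _ _ _ _ hij)
  have hcard := Nat.card_le_card_of_injective _ hinj'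
  rw [Nat.card_prod, Nat.card_fin, Nat.card_coe_set_eq, Nat.card_coe_set_eq] at hcard
  rwa [mul_comm]

end Reduction

end GMA

/-! ### Haar measure and fibres of homomorphisms with finite image -/

section HaarFibers

variable {PG H : Type*} [Group PG] [Group H] (φ : PG →* H) (N : Subgroup PG)

theorem preimage_mul_inter_fiber {g : PG} (hg : g ∈ N) :
    (fun x => g⁻¹ * x) ⁻¹' ((N ⊓ φ.ker : Subgroup PG) : Set PG) = (N : Set PG) ∩ φ ⁻¹' {φ g} := by
  ext x
  simp only [Set.mem_preimage, SetLike.mem_coe, Subgroup.mem_inf, MonoidHom.mem_ker, map_mul,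
    map_inv, inv_mul_eq_one, Set.mem_inter_iff, Set.mem_singleton_iff,
    Subgroup.mul_mem_cancel_left N (N.inv_mem hg)]
  rw [eq_comm (a := φ g)]

variable [TopologicalSpace PG] [IsTopologicalGroup PG] [MeasurableSpace PG] [BorelSpace PG]
  (μ : Measure PG) [μ.IsMulLeftInvariant]

theorem measure_inter_fiber {g : PG} (hg : g ∈ N) :
    μ (N ∩ φ ⁻¹' {φ g}) = μ ((N ⊓ φ.ker : Subgroup PG) : Set PG) := by
  rw [← preimage_mul_inter_fiber φ N hg, measure_preimage_mul]

/-- M is covered by the fibres it meets, which are translates of N ∩ ker φ; no measurability of M or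
of the fibres is needed for this direction. -/
theorem measure_le_ncard_image_mul {M : Set PG} (hM : M ⊆ N) (hfin : (φ '' N).Finite) :
    μ M ≤ (φ '' M).ncard * μ ((N ⊓ φ.ker : Subgroup PG) : Set PG) := by
  classical
  have hfinM : (φ '' M).Finite := hfin.subset (Set.image_mono hM)
  have hsub : M ⊆ ⋃ u ∈ hfinM.toFinset, (N ∩ φ ⁻¹' {u} : Set PG) := by
    intro g hg
    simp only [Set.mem_iUnion, Set.Finite.mem_toFinset]
    exact ⟨φ g, ⟨g, hg, rfl⟩, hM hg, rfl⟩
  refine (measure_mono hsub).trans ((measure_biUnion_finset_le _ _).trans ?_)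
  rw [Set.ncard_eq_toFinset_card _ hfinM, ← nsmul_eq_mul, ← Finset.sum_const]
  refine Finset.sum_le_sum fun u hu => ?_
  obtain ⟨g, hg, rfl⟩ := (Set.Finite.mem_toFinset _).1 hu
  exact (measure_inter_fiber φ N μ (hM hg)).le

theorem ncard_image_mul_measure (hN : IsOpen (N : Set PG)) (hφ : IsOpen (φ.ker : Set PG))
    (hfin : (φ '' N).Finite) :
    (φ '' N).ncard * μ ((N ⊓ φ.ker : Subgroup PG) : Set PG) = μ N := by
  classical
  have hU : (N : Set PG) = ⋃ u ∈ hfin.toFinset, (N ∩ φ ⁻¹' {u} : Set PG) := by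
    ext g
    simp only [Set.mem_iUnion, Set.Finite.mem_toFinset]
    exact ⟨fun hg => ⟨φ g, ⟨g, hg, rfl⟩, hg, rfl⟩, fun ⟨_, _, hg, _⟩ => hg⟩
  conv_rhs => rw [hU]
  rw [measure_biUnion_finset]
  · rw [Set.ncard_eq_toFinset_card _ hfin, ← nsmul_eq_mul, ← Finset.sum_const]
    refine Finset.sum_congr rfl fun u hu => ?_
    obtain ⟨g, hg, rfl⟩ := (Set.Finite.mem_toFinset _).1 hu
    exact (measure_inter_fiber φ N μ hg).symm
  · intro u _ v _ huv
    refine Set.disjoint_left.2 fun g hg hg' => huv ?_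
    rw [← hg.2, ← hg'.2]
  · intro u hu
    obtain ⟨g, hg, rfl⟩ := (Set.Finite.mem_toFinset _).1 hu
    rw [← preimage_mul_inter_fiber φ N hg]
    have : IsOpen ((N ⊓ φ.ker : Subgroup PG) : Set PG) := hN.inter hφ
    exact (this.preimage (continuous_const_mul g⁻¹)).measurableSet

end HaarFibers

namespace GMA

/-! ### Separation by open ideals -/

section Separation

variable {p : ℕ} [Fact p.Prime] {PG F A B C : Type*} [Group PG] [Field F] [CharP F p] [CommRing A]
  [Algebra F A] [AddCommGroup B] [Module A B] [AddCommGroup C] [Module A C] {R : GMA A B C}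
  {ρ : PG →* R.Algˣ} [TopologicalSpace A] [IsTopologicalRing A]

theorem eq_zero_of_forall_mem_open_ideal [CompactSpace A] [T2Space A] (hpA : ∀ x : A, p • x = 0) {a : A}
    (ha : ∀ I : Ideal A, IsOpen (I : Set A) → a ∈ I) : a = 0 := by
  by_contra hne
  obtain ⟨I, hI, hIV⟩ := exists_open_ideal_subset hpA
    (isOpen_compl_singleton.mem_nhds (Ne.symm hne) : {a}ᶜ ∈ nhds (0 : A))
  exact hIV (ha I hI) rfl

/-- Open ideals separate the points of A, so all traces tr(yx) vanish. Faithfulness also asks for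
det y = 0, which follows from 2 det y = (tr y)² - tr(y²). -/
theorem eq_zero_of_forall_mem_traceIdeal [CompactSpace A] [T2Space A] (hp : 2 < p)
    (hpA : ∀ x : A, p • x = 0) (hR : R.IsFaithful) {y : R.Alg}
    (hy : ∀ I : Ideal A, IsOpen (I : Set A) → y ∈ R.traceIdeal I) : y = 0 := by
  have htr : ∀ x : R.Alg, tr (y * x) = 0 := fun x =>
    eq_zero_of_forall_mem_open_ideal hpA fun I hI => by
      rw [tr_mul_comm]
      exact hy I hI x
  refine hR y ?_ htr
  obtain ⟨k, hk⟩ := exists_two_mul_natCast_eq_one hp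
    (show ((p : ℕ) : A) = 0 by simpa using hpA 1)
  have h1 := two_mul_det y
  have h2 := htr 1
  rw [mul_one] at h2
  rw [htr, h2, mul_zero, sub_zero] at h1
  calc det y = 2 * k * det y := by rw [hk, one_mul]
    _ = k * (2 * det y) := by ring
    _ = 0 := by rw [h1, mul_zero]

variable [TopologicalSpace PG] [IsTopologicalGroup PG] {t : PG → A}
  {d : PG →* Aˣ}

variable (F) in
theorem continuous_tr_mul_pinkTheta (ht : Continuous t) (hρ : IsTDRep t d R ρ) (g : PG) :
    Continuous fun h => tr ((ρ g : R.Alg) * pinkTheta F (ρ h : R.Alg)) := by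
  have h1 : ∀ h, tr ((ρ g : R.Alg) * pinkTheta F (ρ h : R.Alg)) =
      t (g * h) - algebraMap F A 2⁻¹ * t h * t g := by
    intro h
    rw [pinkTheta, mul_sub, tr_sub, mul_smul_comm, tr_smul, mul_one, ← Units.val_mul, ← map_mul,
      hρ.tr_eq, hρ.tr_eq, hρ.tr_eq, Algebra.smul_def]
  simp_rw [h1]
  fun_prop

theorem isClosed_setOf_sub_mem_traceIdeal (ht : Continuous t) (hρ : IsTDRep t d R ρ)
    {I : Ideal A} (hI : IsOpen (I : Set A)) (x : R.Alg) :
    IsClosed {z : PG × PG | pinkTheta F (ρ z.1 : R.Alg) - pinkTheta F (ρ z.2 : R.Alg) - x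
      ∈ R.traceIdeal I} := by
  have hIc : IsClosed (I : Set A) := AddSubgroup.isClosed_of_isOpen I.toAddSubgroup hI
  have : {z : PG × PG | pinkTheta F (ρ z.1 : R.Alg) - pinkTheta F (ρ z.2 : R.Alg) - x
      ∈ R.traceIdeal I} = ⋂ g : PG, {z : PG × PG | tr ((ρ g : R.Alg) * pinkTheta F (ρ z.1 : R.Alg))
        - tr ((ρ g : R.Alg) * pinkTheta F (ρ z.2 : R.Alg)) - tr ((ρ g : R.Alg) * x) ∈ I} := by
    ext z
    simp only [Set.mem_ofPred_eq, Set.mem_iInter, ← tr_sub, ← mul_sub]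
    exact ⟨fun h g => h _, fun h => mem_traceIdeal_of_span hρ.span_eq_top h⟩
  rw [this]
  refine isClosed_iInter fun g => hIc.preimage ?_
  have hc := continuous_tr_mul_pinkTheta F ht hρ g
  exact ((hc.comp continuous_fst).sub (hc.comp continuous_snd)).sub continuous_const

/-- Otherwise the closed sets of bad pairs, directed as I shrinks, have a common point in M × M;
there the difference lies in every trace ideal and so is zero. -/
theorem exists_open_ideal_sub_notMem [CompactSpace A] [T2Space A] [T2Space PG] (hp : 2 < p) (ht : Continuous t)
    (hρ : IsTDRep t d R ρ) {M : Set PG} (hM : IsCompact M) {x : R.Alg}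
    (hx : ∀ g ∈ M, ∀ h ∈ M,
      pinkTheta F (ρ g : R.Alg) - pinkTheta F (ρ h : R.Alg) - x ≠ 0) :
    ∃ I : Ideal A, IsOpen (I : Set A) ∧ ∀ g ∈ M, ∀ h ∈ M,
      pinkTheta F (ρ g : R.Alg) - pinkTheta F (ρ h : R.Alg) - x ∉ R.traceIdeal I := by
  by_contra! hcon
  have hpA : ∀ x : A, p • x = 0 := fun x => by
    rw [nsmul_eq_mul, ← map_natCast (algebraMap F A), CharP.cast_eq_zero, map_zero, zero_mul]
  let K : {I : Ideal A // IsOpen (I : Set A)} → Set (PG × PG) := fun I =>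
    (M ×ˢ M) ∩ {z : PG × PG | pinkTheta F (ρ z.1 : R.Alg) - pinkTheta F (ρ z.2 : R.Alg) - x
      ∈ R.traceIdeal I.1}
  have hMM : IsCompact (M ×ˢ M) := hM.prod hM
  have hKc : ∀ I, IsClosed (K I) := fun I =>
    hMM.isClosed.inter (isClosed_setOf_sub_mem_traceIdeal ht hρ I.2 x)
  have : Nonempty {I : Ideal A // IsOpen (I : Set A)} := ⟨⟨⊤, isOpen_univ⟩⟩
  obtain ⟨z, hz⟩ := IsCompact.nonempty_iInter_of_directed_nonempty_isCompact_isClosed K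
    (fun I I' => ⟨⟨I.1 ⊓ I'.1, I.2.inter I'.2⟩,
      Set.inter_subset_inter_right _ fun z hz => traceIdeal_mono inf_le_left hz,
      Set.inter_subset_inter_right _ fun z hz => traceIdeal_mono inf_le_right hz⟩)
    (fun I => by
      obtain ⟨g, hg, h, hh, hmem⟩ := hcon I.1 I.2
      exact ⟨(g, h), ⟨hg, hh⟩, hmem⟩)
    (fun I => hMM.of_isClosed_subset (hKc I) Set.inter_subset_left) hKc
  rw [Set.mem_iInter] at hz
  have hzM := (hz ⟨⊤, isOpen_univ⟩).1
  exact hx z.1 hzM.1 z.2 hzM.2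
    (eq_zero_of_forall_mem_traceIdeal hp hpA hρ.faithful fun I hI => (hz ⟨I, hI⟩).2)

end Separation

/-! ### Openness of the residual kernel -/

section Residual

variable {p : ℕ} {F : Type*} [Field F] [TopologicalSpace F] [DiscreteTopology F]
  {A : Type*} [CommRing A] [TopologicalSpace A] [Algebra F A]
  {PG : Type*} [Group PG] [TopologicalSpace PG]
  {ρbar : MaximalSpectrum A → (PG →* GL (Fin 2) F)} {t : PG → A} {d : PG →* Aˣ}
  {B C : Type*} [AddCommGroup B] [Module A B] [AddCommGroup C] [Module A C]
  {R : GMA A B C} {ρ : PG →* R.Algˣ}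

theorem isOpen_ker_residual {r : PG →* GL (Fin 2) F} (hr : Continuous r) :
    IsOpen (r.ker : Set PG) := by
  have hd : DiscreteTopology (Matrix (Fin 2) (Fin 2) F) :=
    inferInstanceAs (DiscreteTopology (Fin 2 → Fin 2 → F))
  have : (r.ker : Set PG) = (fun g => (r g : Matrix (Fin 2) (Fin 2) F)) ⁻¹' {1} := by
    ext g
    rw [SetLike.mem_coe, MonoidHom.mem_ker, Units.ext_iff, Set.mem_preimage, Set.mem_singleton_iff,
      Units.val_one]
  rw [this]
  exact (isOpen_discrete _).preimage (Units.continuous_val.comp hr)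

/-- If g is trivial under every residual representation, then t(hg) ≡ t(h) and d(g) ≡ 1 modulo each
maximal ideal, which puts ρ(g) - 1 in the radical. There are finitely many such representations,
each with open kernel. -/
theorem isOpen_ker_residualHom [IsTopologicalGroup PG] [Finite (MaximalSpectrum A)]
    (hadm : IsAdmissiblePseudoDeformation p ρbar t d) (hρ : IsTDRep t d R ρ) :
    IsOpen ((residualHom ρ).ker : Set PG) := by
  refine Subgroup.isOpen_mono (H₁ := ⨅ 𝔪, (ρbar 𝔪).ker) (fun g hg => ?_) ?_
  · rw [Subgroup.mem_iInf] at hg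
    have htr : ∀ 𝔪 : MaximalSpectrum A, (ρ g : R.Alg) - 1 ∈ R.traceIdeal 𝔪.asIdeal := by
      intro 𝔪
      refine mem_traceIdeal_of_span hρ.span_eq_top fun h => ?_
      rw [mul_sub, mul_one, tr_sub, ← Units.val_mul, ← map_mul, hρ.tr_eq, hρ.tr_eq]
      have h1 := hadm.deform_t 𝔪 (h * g)
      have h2 := hadm.deform_t 𝔪 h
      rw [map_mul, (MonoidHom.mem_ker).1 (hg 𝔪), mul_one] at h1
      convert 𝔪.asIdeal.sub_mem h1 h2 using 1
      ring
    refine mem_ker_residualHom.2 (mem_jacobson_of_forall_mem (fun x 𝔪 => htr 𝔪 x) fun 𝔪 => ?_)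
    have h1 := det_one_add ((ρ g : R.Alg) - 1)
    rw [add_sub_cancel, hρ.det_eq] at h1
    have h2 := hadm.deform_d 𝔪 g
    rw [(MonoidHom.mem_ker).1 (hg 𝔪), Units.val_one, Matrix.det_one, map_one] at h2
    have h3 := htr 𝔪 1
    rw [one_mul] at h3
    convert 𝔪.asIdeal.sub_mem h2 h3 using 1
    rw [h1]
    ring
  · rw [Subgroup.coe_iInf]
    exact isOpen_iInter_of_finite fun 𝔪 => isOpen_ker_residual (hadm.residual_continuous 𝔪)

end Residual

/-! ### The density estimate -/

section Density

variable {p : ℕ} [Fact p.Prime] {F : Type*} [Field F] [CharP F p]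
  {A : Type*} [CommRing A] [TopologicalSpace A] [IsTopologicalRing A]
  [CompactSpace A] [T2Space A] [Algebra F A]
  {PG : Type*} [Group PG] [TopologicalSpace PG] [IsTopologicalGroup PG] [CompactSpace PG]
  [T2Space PG] [MeasurableSpace PG] [BorelSpace PG] {t : PG → A} {d : PG →* Aˣ}
  {B C : Type*} [AddCommGroup B] [Module A B] [AddCommGroup C] [Module A C]
  {R : GMA A B C} {ρ : PG →* R.Algˣ}

/-- The additive function y ↦ l(tr(ρ(g₀)y)) kills Θ(ρ(g)) - Θ(ρ(h)) for g, h in M, but not kx with 0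
< k < p. So the translates of Θ(ρ(M)) by multiples of x are disjoint, and remain so modulo a
suitable open ideal. -/
theorem mul_measure_le_of_isCompact (hp : 2 < p) (ht : Continuous t) (hρ : IsTDRep t d R ρ)
    (hdet : ∀ g ∈ (residualHom ρ).ker, det (ρ g : R.Alg) = 1)
    (hopen : IsOpen ((residualHom ρ).ker : Set PG)) (l : A →ₗ[F] F) {g₀ : PG}
    (hg₀ : tr (ρ g₀ : R.Alg) = 0) {x : R.Alg} (hx : x ∈ pinkLie₂ F ρ)
    (hlx : l (tr ((ρ g₀ : R.Alg) * x)) ≠ 0) (μ : Measure PG) [μ.IsMulLeftInvariant] {M : Set PG}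
    (hMc : IsCompact M) (hM : M ⊆ (residualHom ρ).ker) (hlM : ∀ g ∈ M, l (t (g₀ * g)) = 0) :
    (p : ENNReal) * μ M ≤ μ ((residualHom ρ).ker : Set PG) := by
  have hsep : ∀ k : Fin p, ∃ I : Ideal A, IsOpen (I : Set A) ∧ (0 < k.1 → ∀ g ∈ M, ∀ h ∈ M,
      pinkTheta F (ρ g : R.Alg) - pinkTheta F (ρ h : R.Alg) - k.1 • x ∉ R.traceIdeal I) := by
    intro k
    by_cases hk : 0 < k.1
    · obtain ⟨I, hI, hIM⟩ := exists_open_ideal_sub_notMem (F := F) (x := k.1 • x) hp ht hρ hMc (by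
        intro g hg h hh h0
        have h1 := congrArg (fun y => l (tr ((ρ g₀ : R.Alg) * y))) h0
        simp only [mul_sub, tr_sub, mul_smul_comm, tr_nsmul, mul_zero, tr_zero, map_zero, map_sub,
          map_nsmul, tr_mul_pinkTheta hg₀, ← Units.val_mul] at h1
        rw [← map_mul, ← map_mul, hρ.tr_eq, hρ.tr_eq, hlM g hg, hlM h hh, sub_zero, zero_sub,
          neg_eq_zero, nsmul_eq_mul, mul_eq_zero, CharP.cast_eq_zero_iff F p] at h1
        rcases h1 with h1 | h1
        · exact absurd (Nat.le_of_dvd hk h1) (by omega)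
        · exact hlx h1)
      exact ⟨I, hI, fun _ => hIM⟩
    -- The index k = 0 imposes nothing; the unit ideal does not affect the intersection taken below.
    · exact ⟨⊤, isOpen_univ, fun h => absurd h hk⟩
  choose I hIo hIM using hsep
  have hIo' : IsOpen ((⨅ k, I k : Ideal A) : Set A) := by
    rw [Submodule.coe_iInf]
    exact isOpen_iInter_of_finite hIo
  have hfinQ := finite_quotient_traceIdeal ht hρ hIo'
  have hcount := mul_ncard_traceHom_image_le hdet hp hIo' hx hM (by
    intro k hk0 hkp g hg h hh hmem
    exact hIM ⟨k, hkp⟩ hk0 g hg h hh (traceIdeal_mono (iInf_le I ⟨k, hkp⟩) hmem))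
  have hfin : (traceHom ρ (⨅ k, I k) '' ((residualHom ρ).ker : Set PG)).Finite := Set.toFinite _
  rw [← ncard_image_mul_measure (traceHom ρ (⨅ k, I k)) _ μ hopen
    (isOpen_ker_traceHom ht hρ hIo') hfin]
  calc (p : ENNReal) * μ M
      ≤ p * ((traceHom ρ (⨅ k, I k) '' M).ncard *
          μ (((residualHom ρ).ker ⊓ (traceHom ρ (⨅ k, I k)).ker : Subgroup PG) : Set PG)) := by
        gcongr
        exact measure_le_ncard_image_mul _ _ μ hM hfin
    _ ≤ _ := by
        rw [← mul_assoc]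
        gcongr
        exact_mod_cast hcount

theorem measure_ker_residualHom_le (hp : 2 < p) (ht : Continuous t) (hρ : IsTDRep t d R ρ)
    (hdet : ∀ g ∈ (residualHom ρ).ker, det (ρ g : R.Alg) = 1)
    (hopen : IsOpen ((residualHom ρ).ker : Set PG)) (l : A →ₗ[F] F) {g₀ : PG}
    (hg₀ : tr (ρ g₀ : R.Alg) = 0) {x : R.Alg} (hx : x ∈ pinkLie₂ F ρ)
    (hlx : l (tr ((ρ g₀ : R.Alg) * x)) ≠ 0) (μ : Measure PG) [μ.IsMulLeftInvariant] [μ.Regular] :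
    μ ((residualHom ρ).ker : Set PG) ≤
      μ ((residualHom ρ).ker : Set PG) / p + μ {g : PG | l (t g) ≠ 0} := by
  set N := ((residualHom ρ).ker : Set PG) with hN
  set S := {g : PG | l (t g) ≠ 0} with hS
  -- A measurable hull has the same outer measure as S and makes N \ S' measurable. Inner regularity
  -- by compact sets then applies even when l is discontinuous.
  set S' := (fun g => g₀ * g) ⁻¹' toMeasurable μ S with hS'
  have hS'm : MeasurableSet S' :=
    (continuous_const_mul g₀).measurable (measurableSet_toMeasurable μ S)
  have hp0 : (p : ENNReal) ≠ 0 := by exact_mod_cast (Fact.out : p.Prime).ne_zero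
  have hbound : μ (N \ S') ≤ μ N / p := by
    have hm : MeasurableSet (N \ S') := hopen.measurableSet.diff hS'm
    rw [hm.measure_eq_iSup_isCompact_of_ne_top (measure_ne_top μ _)]
    refine iSup_le fun M => iSup_le fun hM => iSup_le fun hMc => ?_
    rw [ENNReal.le_div_iff_mul_le (Or.inl hp0) (Or.inl (ENNReal.natCast_ne_top p)), mul_comm]
    refine mul_measure_le_of_isCompact hp ht hρ hdet hopen l hg₀ hx hlx μ hMc
      (fun g hg => (hM hg).1) fun g hg => ?_
    by_contra hne
    exact (hM hg).2 (subset_toMeasurable μ S hne)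
  calc μ N ≤ μ (N \ S') + μ S' := by
        refine (measure_mono fun g hg => ?_).trans (measure_union_le _ _)
        by_cases h : g ∈ S'
        · exact Or.inr h
        · exact Or.inl ⟨hg, h⟩
    _ ≤ μ N / p + μ S := by
        refine add_le_add hbound (le_of_eq ?_)
        rw [hS', measure_preimage_mul, measure_toMeasurable]

end Density

end GMA

theorem mainTheorem6 {p : ℕ} [Fact p.Prime] (hp : 2 < p)
    {F : Type*} [Field F] [Finite F] [CharP F p] [TopologicalSpace F] [DiscreteTopology F]
    {A : Type*} [CommRing A] [TopologicalSpace A] [IsTopologicalRing A]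
    [CompactSpace A] [T2Space A] [Algebra F A] (hA : IsSemilocalWithResidueField F A)
    {PG : Type*} [Group PG] [TopologicalSpace PG] [IsTopologicalGroup PG] [CompactSpace PG]
    [T2Space PG] [TotallyDisconnectedSpace PG] [MeasurableSpace PG] [BorelSpace PG]
    (ρbar : MaximalSpectrum A → (PG →* GL (Fin 2) F)) (t : PG → A) (d : PG →* Aˣ)
    (hadm : IsAdmissiblePseudoDeformation p ρbar t d)
    {B C : Type*} [AddCommGroup B] [Module A B] [AddCommGroup C] [Module A C]
    (R : GMA A B C) (ρ : PG →* R.Algˣ) (hρ : IsTDRep t d R ρ)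
    (hodd : GMA.IsWeaklyOdd ρ)
    (l : A →ₗ[F] F) (hl : ∃ a ∈ GMA.essentialSubmodule F ρ, l a ≠ 0) :
    Finite (GMA.residualImage ρ) ∧
      ((p : ℝ) - 1) / ((p : ℝ) * (Nat.card (GMA.residualImage ρ) : ℝ)) ≤
        (Measure.haarMeasure (⊤ : PositiveCompacts PG)).real {g : PG | l (t g) ≠ 0} := by
  have hss := hA.semilocal
  obtain ⟨a, ha, hla⟩ := hl
  have hnt : Nontrivial A := ⟨a, 0, fun h => hla (by rw [h, map_zero])⟩
  obtain ⟨g₀, hg₀, x, hx, hlx⟩ : ∃ g₀ : PG, GMA.tr (ρ g₀ : R.Alg) = 0 ∧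
      ∃ x ∈ GMA.pinkLie₂ F ρ, l (GMA.tr ((ρ g₀ : R.Alg) * x)) ≠ 0 := by
    by_contra! hcon
    refine hla (LinearMap.mem_ker.1 ((Submodule.span_le (p := LinearMap.ker l)).2 ?_ ha))
    rintro _ ⟨_, ⟨⟨g, rfl⟩, hg, -⟩, x, hx, rfl⟩
    exact hcon g hg x hx
  have hopen := GMA.isOpen_ker_residualHom hadm hρ
  have hdet : ∀ g ∈ (GMA.residualHom ρ).ker, GMA.det (ρ g : R.Alg) = 1 := fun g hg =>
    GMA.det_eq_one_of_mem_ker_residualHom hg (by rw [hρ.det_eq]; exact hadm.constant_det g)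
  have hfin : Finite (GMA.residualHom ρ).range := by
    have : Finite (PG ⧸ (GMA.residualHom ρ).ker) := Subgroup.quotient_finite_of_isOpen _ hopen
    exact Finite.of_equiv _ (QuotientGroup.quotientKerEquivRange (GMA.residualHom ρ)).toEquiv
  rw [GMA.residualImage_eq_range]
  refine ⟨hfin, ?_⟩
  set μ := Measure.haarMeasure (⊤ : PositiveCompacts PG) with hμ
  have hμuniv : μ Set.univ = 1 := by
    have := Measure.haarMeasure_self (K₀ := (⊤ : PositiveCompacts PG))
    rwa [PositiveCompacts.coe_top] at this
  set n := Nat.card (GMA.residualHom ρ).range with hn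
  have hcard : (n : ENNReal) * μ ((GMA.residualHom ρ).ker : Set PG) = 1 := by
    have himage : GMA.residualHom ρ '' ((⊤ : Subgroup PG) : Set PG) =
        (GMA.residualHom ρ).range := by simp
    have h := ncard_image_mul_measure (GMA.residualHom ρ) ⊤ μ isOpen_univ hopen
      (by rw [himage]; exact Set.toFinite _)
    rw [himage, top_inf_eq, Subgroup.coe_top, hμuniv] at h
    exact h
  have hmain := GMA.measure_ker_residualHom_le hp hadm.continuous_t hρ hdet hopen l hg₀ hx hlx μ
  have hp0 : (0 : ℝ) < p := by exact_mod_cast (Fact.out : p.Prime).pos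
  have hcard' : (n : ℝ) * μ.real ((GMA.residualHom ρ).ker : Set PG) = 1 := by
    have := congrArg ENNReal.toReal hcard
    rwa [ENNReal.toReal_mul, ENNReal.toReal_natCast, ENNReal.toReal_one] at this
  have hmain' : μ.real ((GMA.residualHom ρ).ker : Set PG) ≤
      μ.real ((GMA.residualHom ρ).ker : Set PG) / p + μ.real {g : PG | l (t g) ≠ 0} := by
    have hp0' : (p : ENNReal) ≠ 0 := by exact_mod_cast (Fact.out : p.Prime).ne_zero
    have h1 : μ ((GMA.residualHom ρ).ker : Set PG) / p ≠ ⊤ :=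
      ENNReal.div_ne_top (measure_ne_top μ _) hp0'
    have := ENNReal.toReal_mono (ENNReal.add_ne_top.2 ⟨h1, measure_ne_top μ _⟩) hmain
    rwa [ENNReal.toReal_add h1 (measure_ne_top μ _), ENNReal.toReal_div,
      ENNReal.toReal_natCast] at this
  have hn0 : (n : ℝ) ≠ 0 := fun h => by rw [h, zero_mul] at hcard'; exact zero_ne_one hcard'
  have hN : μ.real ((GMA.residualHom ρ).ker : Set PG) = 1 / n := by
    rw [eq_div_iff hn0, mul_comm]; exact hcard'
  rw [hN] at hmain'
  calc ((p : ℝ) - 1) / (p * n) = 1 / n - 1 / n / p := by field_simp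
    _ ≤ _ := by linarith
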